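/- All graphs are finite, undirected and simple. For a graph $G$ let $D(G)$ be the set of vertices missed by some maximum matching of $G$, let $A(G)$ be the set of vertices outside $D(G)$ that have a neighbour in $D(G)$, and let $C(G)=V(G)\setminus(D(G)\cup A(G))$. For $S\subseteq V(G)$ let $N(S)$ be the set of vertices having a neighbour in $S$, let $\partial_G(S)$ be the set of vertices of $S$ having a neighbour outside $S$, and let $d_G(S)=|S|-|N(S)|$. A \emph{critical independent set} is an independent set $S$ with $d_G(S)=\max\{d_G(T): T \text{ independent}\}$; a \emph{maximum} critical independent set is one of largest cardinality. Let $\mathrm{nucleus}(G)$ be the intersection of all maximum critical independent sets of $G$, and $\mathrm{diadem}(G)$ the union of all critical independent sets of $G$. A graph is \emph{almost bipartite} if it has exactly one odd cycle, and \emph{König--Egerváry} if $\alpha(G)+\mu(G)=|V(G)|$, where $\alpha(G)$ is the largest size of an independent set and $\mu(G)$ the largest size of a matching. For a matching $M$, an \emph{$M$-blossom} is an odd cycle of length $2k+1$ with exactly $k$ edges in $M$; its \emph{base} is its vertex that is incident with none of these $k$ edges. An \emph{$M$-flower} is an $M$-blossom together with an $M$-alternating path of even (possibly zero) length from the base to a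 vertex not saturated by $M$, the base being the only common vertex of the path and the blossom. For an odd cycle $C$ of $G$, $R(C)$ is the union of the vertex sets of all $M$-flowers with blossom $C$, over all maximum matchings $M$ of $G$. A \emph{BAB-graph} is a graph $G$ obtained from the disjoint union of graphs $B,G_1,\dots,G_k$ ($k\ge 0$), where $B$ is a (possibly empty) bipartite graph and each $G_i$ is an almost bipartite non-König--Egerváry graph whose unique odd cycle $C_i$ satisfies $R(C_i)=V(G_i)$ (computed in $G_i$), by adding edges between vertices belonging to different graphs of the list, in such a way that $$\partial_G(V(B))\subseteq A(B)\cup C(B)\quad\text{and}\quad \partial_G(V(G_i))\subseteq A(G_i)\ \ (i=1,\dots,k).$$ \textbf{Theorem.} Let $G$ be a BAB-graph, and let $X$ be the set of isolated vertices of the induced subgraph $G[D(G)]$. Then $$\mathrm{nucleus}(G)=X .$$ Consequently, $\mathrm{nucleus}(G)\subseteq \mathrm{diadem}(G)$. -/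

import Mathlib

namespace BABGraph

universe u

variable {V : Type u}

/-- The neighbourhood `N(S)`: all vertices having a neighbour in `S`. -/
def nbhd (G : SimpleGraph V) (S : Set V) : Set V :=
  {w | ∃ v ∈ S, G.Adj v w}

/-- The difference `d_G(S) = |S| - |N(S)|`. -/
noncomputable def diff (G : SimpleGraph V) (S : Set V) : ℤ :=
  (S.ncard : ℤ) - ((nbhd G S).ncard : ℤ)

/-- A critical independent set: an independent set whose difference is the maximum
of the differences of the independent sets of `G`. -/
def IsCriticalIndepSet (G : SimpleGraph V) (S : Set V) : Prop :=
  G.IsIndepSet S ∧ ∀ T : Set V, G.IsIndepSet T → diff G T ≤ diff G S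

/-- A critical independent set of maximum cardinality. -/
def IsMaximumCriticalIndepSet (G : SimpleGraph V) (S : Set V) : Prop :=
  IsCriticalIndepSet G S ∧ ∀ T : Set V, IsCriticalIndepSet G T → T.ncard ≤ S.ncard

/-- The intersection of all maximum critical independent sets. -/
def nucleus (G : SimpleGraph V) : Set V :=
  ⋂₀ {S | IsMaximumCriticalIndepSet G S}

/-- The union of all critical independent sets. -/
def diadem (G : SimpleGraph V) : Set V :=
  ⋃₀ {S | IsCriticalIndepSet G S}

/-- A matching of `G` with the largest number of edges. -/
def IsMaximumMatching (G : SimpleGraph V) (M : G.Subgraph) : Prop :=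
  M.IsMatching ∧ ∀ M' : G.Subgraph, M'.IsMatching → M'.edgeSet.ncard ≤ M.edgeSet.ncard

/-- The matching number `μ(G)`. -/
noncomputable def matchingNumber (G : SimpleGraph V) : ℕ :=
  sSup {n | ∃ M : G.Subgraph, M.IsMatching ∧ M.edgeSet.ncard = n}

/-- `α(G) + μ(G)` equals the order of `G`. -/
def IsKonigEgervary (G : SimpleGraph V) : Prop :=
  G.indepNum + matchingNumber G = Nat.card V

/-- The vertices missed by some maximum matching (a subgraph that is a matching has as its
vertices exactly the saturated ones). -/
def setD (G : SimpleGraph V) : Set V :=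
  {v | ∃ M : G.Subgraph, IsMaximumMatching G M ∧ v ∉ M.verts}

/-- The vertices outside `D(G)` with a neighbour in `D(G)`. -/
def setA (G : SimpleGraph V) : Set V :=
  {v | (∃ w ∈ setD G, G.Adj v w) ∧ v ∉ setD G}

/-- The vertices neither in `D(G)` nor in `A(G)`. -/
def setC (G : SimpleGraph V) : Set V :=
  (setD G ∪ setA G)ᶜ

/-- The set of isolated vertices of the induced subgraph `G[D(G)]`, as vertices of `G`. -/
def isolatedD (G : SimpleGraph V) : Set V :=
  Subtype.val '' {v : setD G | (G.induce (setD G)).IsIsolated v}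

/-- The subgraph `C` of `G` is a cycle of odd length. -/
def IsOddCycle (G : SimpleGraph V) (C : G.Subgraph) : Prop :=
  ∃ (v : V) (c : G.Walk v v), c.IsCycle ∧ Odd c.length ∧ c.toSubgraph = C

/-- `G` has exactly one odd cycle (cycles being subgraphs). -/
def IsAlmostBipartite (G : SimpleGraph V) : Prop :=
  ∃! C : G.Subgraph, IsOddCycle G C

/-- The closed walk `c` is an `M`-blossom with base `b`: a cycle of length `2k + 1` with
exactly `k` edges in `M`, none of which is incident with `b`. -/
def IsBlossom {G : SimpleGraph V} (M : G.Subgraph) {b : V} (c : G.Walk b b) : Prop :=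
  c.IsCycle ∧
  (∃ k : ℕ, c.length = 2 * k + 1 ∧ {e | e ∈ c.edges ∧ e ∈ M.edgeSet}.ncard = k) ∧
  ∀ e ∈ c.edges, e ∈ M.edgeSet → b ∉ e

/-- Of any two consecutive edges of `p`, exactly one belongs to `M`. -/
def IsAlternating {G : SimpleGraph V} (M : G.Subgraph) {x y : V} (p : G.Walk x y) : Prop :=
  p.edges.IsChain (fun e f => e ∈ M.edgeSet ↔ f ∉ M.edgeSet)

/-- The blossom `c` with base `b` and the stem `p` from `b` to the root `r` form
an `M`-flower. -/
def IsFlower {G : SimpleGraph V} (M : G.Subgraph) {b r : V} (c : G.Walk b b)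
    (p : G.Walk b r) : Prop :=
  IsBlossom M c ∧
  p.IsPath ∧ Even p.length ∧ IsAlternating M p ∧ r ∉ M.verts ∧
  ∀ v, v ∈ c.support → v ∈ p.support → v = b

/-- The reach set `R(C)`: the union of the vertex sets of all `M`-flowers with blossom `C`,
over all maximum matchings `M`. -/
def reachSet (G : SimpleGraph V) (C : G.Subgraph) : Set V :=
  {v | ∃ M : G.Subgraph, IsMaximumMatching G M ∧
    ∃ (b r : V) (c : G.Walk b b) (p : G.Walk b r),
      IsFlower M c p ∧ c.toSubgraph = C ∧ (v ∈ c.support ∨ v ∈ p.support)}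

/-- The vertices of `S` having a neighbour outside `S`. -/
def boundary (G : SimpleGraph V) (S : Set V) : Set V :=
  {v | v ∈ S ∧ ∃ w, w ∉ S ∧ G.Adj v w}

/-- `G` is a BAB-graph `(B, G₁, …, G_k)`. The map `part` records to which of the disjoint graphs
each vertex belongs (`none` for `B`, `some i` for `G_i`). As all added edges join different
parts, `B` and the `G_i` are the subgraphs of `G` induced by the parts. -/
def IsBAB (G : SimpleGraph V) : Prop :=
  ∃ (k : ℕ) (part : V → Option (Fin k)),
    let VB : Set V := {v | part v = none}
    let VG : Fin k → Set V := fun i => {v | part v = some i}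
    (G.induce VB).IsBipartite ∧
    boundary G VB ⊆ Subtype.val '' (setA (G.induce VB) ∪ setC (G.induce VB)) ∧
    ∀ i : Fin k,
      IsAlmostBipartite (G.induce (VG i)) ∧
      ¬ IsKonigEgervary (G.induce (VG i)) ∧
      (∀ C : (G.induce (VG i)).Subgraph, IsOddCycle (G.induce (VG i)) C →
        reachSet (G.induce (VG i)) C = Set.univ) ∧
      boundary G (VG i) ⊆ Subtype.val '' setA (G.induce (VG i))

end BABGraph

set_option linter.unusedSectionVars false

namespace BABGraph

universe u

variable {V : Type u}

/-! Let `G'` be the disjoint union of the parts, without the added edges. The boundary conditions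
say that no added edge meets D(G'). In a bipartite part D is independent. In `G_i`, any edge inside
D closes an odd cycle, so it joins vertices of the unique cycle `C_i`; rotating a maximum matching
along a flower frees any prescribed vertex of `C_i` while the rest of `C_i` stays matched within
itself. The reach condition makes C(G_i) empty, so C(G') lies in `B` and is 2-coloured.
`IsCycleDecomp` records all this except the colouring.

Write X for the isolated vertices of G'[D(G')], A for A(G'). Counting missed vertices gives D(G) =
D(G') (`setD_eq`), so X is the set of the theorem. An independent S omits a vertex of each cycle; a
maximum matching of `G'` missing such vertices shows d(S) ≤ |X| - |A|. Adding to X either colour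
class of C(G') attains this bound and is a maximum critical set
(`isMaximumCriticalIndepSet_sideSet`); these two sets meet in X, so the nucleus lies in X.
Conversely, a maximum critical set omitting a vertex of X would contain its partner in A, and
comparing two maximum matchings on S ∩ A gives a contradiction (`isoD_subset`). -/

/-! ### Matchings as involutions -/

/-- A matching of `G`, encoded as the involution exchanging the ends of each edge. -/
structure IsInv (G : SimpleGraph V) (f : V → V) : Prop where
  invol : ∀ v, f (f v) = v
  adj : ∀ v, f v ≠ v → G.Adj v (f v)

/-- The fixed points of `f`: for a matching, the vertices it misses. -/
def fix (f : V → V) : Set V := {v | f v = v}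

/-- A matching missing the least possible number of vertices. -/
def IsMaxInv (G : SimpleGraph V) (f : V → V) : Prop :=
  IsInv G f ∧ ∀ g, IsInv G g → (fix f).ncard ≤ (fix g).ncard

open Classical in
/-- The function equal to `g` on `P` and to `f` elsewhere. -/
noncomputable def swapOn (P : Set V) (f g : V → V) : V → V := fun v => if v ∈ P then g v else f v

theorem mem_fix {f : V → V} {v : V} : v ∈ fix f ↔ f v = v := Iff.rfl

theorem swapOn_of_mem {P : Set V} {f g : V → V} {v : V} (h : v ∈ P) : swapOn P f g v = g v := by
  simp [swapOn, h]

theorem swapOn_of_notMem {P : Set V} {f g : V → V} {v : V} (h : v ∉ P) :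
    swapOn P f g v = f v := by
  simp [swapOn, h]

theorem IsInv.mapsTo_compl {G : SimpleGraph V} {f : V → V} (hf : IsInv G f) {P : Set V}
    (h : ∀ v ∈ P, f v ∈ P) {v : V} (hv : v ∉ P) : f v ∉ P :=
  fun h' => hv (hf.invol v ▸ h _ h')

theorem IsInv.swapOn {G : SimpleGraph V} {P : Set V} {f g : V → V} (hf : IsInv G f)
    (hfP : ∀ v ∈ P, f v ∈ P)
    (hg : ∀ v ∈ P, g v ∈ P ∧ g (g v) = v ∧ (g v ≠ v → G.Adj v (g v))) :
    IsInv G (swapOn P f g) := by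
  constructor
  · intro v
    by_cases hv : v ∈ P
    · rw [swapOn_of_mem hv, swapOn_of_mem (hg v hv).1, (hg v hv).2.1]
    · rw [swapOn_of_notMem hv, swapOn_of_notMem (hf.mapsTo_compl hfP hv), hf.invol]
  · intro v
    by_cases hv : v ∈ P
    · rw [swapOn_of_mem hv]; exact (hg v hv).2.2
    · rw [swapOn_of_notMem hv]; exact hf.adj v

theorem ncard_fix_swapOn [Finite V] (P : Set V) (f g : V → V) :
    (fix (swapOn P f g)).ncard = (fix f \ P).ncard + (fix g ∩ P).ncard := by
  rw [← Set.ncard_union_eq (by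
    rw [Set.disjoint_left]; rintro v ⟨_, h⟩ ⟨_, h'⟩; exact h h')]
  congr 1
  ext v
  by_cases hv : v ∈ P <;> simp [mem_fix, swapOn, hv]

theorem ncard_fix_split [Finite V] (P : Set V) (f : V → V) :
    (fix f).ncard = (fix f \ P).ncard + (fix f ∩ P).ncard := by
  rw [add_comm, Set.ncard_inter_add_ncard_sdiff_eq_ncard]

theorem IsMaxInv.of_le {G : SimpleGraph V} {f g : V → V} (hf : IsMaxInv G f) (hg : IsInv G g)
    (h : (fix g).ncard ≤ (fix f).ncard) : IsMaxInv G g :=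
  ⟨hg, fun k hk => h.trans (hf.2 k hk)⟩

theorem isInv_id (G : SimpleGraph V) : IsInv G id := ⟨fun _ => rfl, fun _ h => (h rfl).elim⟩

theorem exists_isMaxInv (G : SimpleGraph V) : ∃ f, IsMaxInv G f := by
  classical
  have hex : ∃ n, ∃ f, IsInv G f ∧ (fix f).ncard = n := ⟨_, id, isInv_id G, rfl⟩
  obtain ⟨f, hf, hn⟩ := Nat.find_spec hex
  exact ⟨f, hf, fun g hg => hn ▸ Nat.find_min' hex ⟨g, hg, rfl⟩⟩

/-- The edges `v (f v)` of a fixed-point-free involution on `T`. -/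
theorem two_mul_ncard_edges {T : Set V} [Finite V] {f : V → V}
    (h : ∀ v ∈ T, f v ∈ T ∧ f (f v) = v ∧ f v ≠ v) :
    2 * ((fun v => s(v, f v)) '' T).ncard = T.ncard := by
  classical
  have := Fintype.ofFinite V
  have e1 : T.ncard = T.toFinset.card := Set.ncard_eq_toFinset_card' T
  have e2 : ((fun v => s(v, f v)) '' T).ncard
      = (T.toFinset.image (fun v => s(v, f v))).card := by
    rw [← Set.ncard_coe_finset]; simp
  rw [e1, e2, Finset.card_eq_sum_card_image (fun v => s(v, f v)) T.toFinset,
    Finset.sum_const_nat (m := 2), mul_comm]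
  intro e he
  obtain ⟨v, hv, rfl⟩ := Finset.mem_image.1 he
  rw [Set.mem_toFinset] at hv
  have : (T.toFinset.filter fun a => s(a, f a) = s(v, f v)) = {v, f v} := by
    ext a
    simp only [Finset.mem_filter, Set.mem_toFinset, Finset.mem_insert, Finset.mem_singleton,
      Sym2.eq_iff]
    constructor
    · rintro ⟨_, h | h⟩ <;> simp [h.1]
    · rintro (rfl | rfl)
      · simp [hv]
      · exact ⟨(h v hv).1, Or.inr ⟨rfl, (h v hv).2.1⟩⟩
  rw [this, Finset.card_pair (h v hv).2.2.symm]

theorem IsInv.two_mul_ncard_add {G : SimpleGraph V} [Finite V] {f : V → V} (hf : IsInv G f) :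
    2 * ((fun v => s(v, f v)) '' (fix f)ᶜ).ncard + (fix f).ncard = Nat.card V := by
  rw [two_mul_ncard_edges, add_comm, Set.ncard_add_ncard_compl]
  intro v hv
  refine ⟨fun h => hv ?_, hf.invol v, hv⟩
  rw [mem_fix, hf.invol] at h
  exact h.symm

/-! ### Matchings as subgraphs and as involutions -/

theorem exists_isInv_of_isMatching {G : SimpleGraph V} {M : G.Subgraph} (hM : M.IsMatching) :
    ∃ f, IsInv G f ∧ ∀ v w, M.Adj v w ↔ f v = w ∧ v ≠ w := by
  classical
  let f : V → V := fun v => if h : ∃ w, M.Adj v w then h.choose else v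
  have hf : ∀ v w, M.Adj v w → f v = w := by
    intro v w h
    have hex : ∃ w, M.Adj v w := ⟨w, h⟩
    have : f v = hex.choose := by simp only [f]; rw [dif_pos hex]
    rw [this]
    exact (hM (M.edge_vert h)).unique hex.choose_spec h
  have hf' : ∀ v, f v ≠ v → M.Adj v (f v) := by
    intro v hv
    by_cases hex : ∃ w, M.Adj v w
    · obtain ⟨w, hw⟩ := hex
      rwa [hf v w hw]
    · exact (hv (by simp only [f]; rw [dif_neg hex])).elim
  refine ⟨f, ⟨fun v => ?_, fun v hv => (hf' v hv).adj_sub⟩, fun v w => ⟨fun h =>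
    ⟨hf v w h, h.adj_sub.ne⟩, ?_⟩⟩
  · by_cases hv : f v = v
    · rw [hv, hv]
    · exact hf _ _ (hf' v hv).symm
  · rintro ⟨rfl, h⟩
    exact hf' v h.symm

theorem exists_isMatching_of_isInv {G : SimpleGraph V} {f : V → V} (hf : IsInv G f) :
    ∃ M : G.Subgraph, M.IsMatching ∧ ∀ v w, M.Adj v w ↔ f v = w ∧ v ≠ w := by
  refine ⟨{ verts := (fix f)ᶜ, Adj := fun v w => f v = w ∧ v ≠ w, adj_sub := ?_,
            edge_vert := ?_, symm := ⟨?_⟩ }, ?_, fun _ _ => Iff.rfl⟩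
  · rintro v w ⟨rfl, h⟩; exact hf.adj v h.symm
  · rintro v w ⟨rfl, h⟩; exact h.symm
  · rintro v w ⟨rfl, h⟩; exact ⟨hf.invol v, h.symm⟩
  · intro v hv
    exact ⟨f v, ⟨rfl, Ne.symm hv⟩, fun w hw => hw.1.symm⟩

theorem mem_verts_iff {G : SimpleGraph V} {M : G.Subgraph} (hM : M.IsMatching) {f : V → V}
    (h : ∀ v w, M.Adj v w ↔ f v = w ∧ v ≠ w) {v : V} : v ∈ M.verts ↔ f v ≠ v := by
  constructor
  · intro hv
    obtain ⟨w, hw, -⟩ := hM hv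
    obtain ⟨rfl, h2⟩ := (h v w).1 hw
    exact h2.symm
  · intro hv
    exact M.edge_vert ((h v (f v)).2 ⟨rfl, Ne.symm hv⟩)

theorem two_mul_ncard_edgeSet [Finite V] {G : SimpleGraph V} {M : G.Subgraph} {f : V → V}
    (hf : IsInv G f) (h : ∀ v w, M.Adj v w ↔ f v = w ∧ v ≠ w) :
    2 * M.edgeSet.ncard + (fix f).ncard = Nat.card V := by
  rw [← hf.two_mul_ncard_add]
  congr 3
  ext e
  induction e with | _ v w
  simp only [SimpleGraph.Subgraph.mem_edgeSet, h, Set.mem_image, Set.mem_compl_iff, mem_fix,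
    Sym2.eq_iff]
  constructor
  · rintro ⟨rfl, h⟩; exact ⟨v, h.symm, Or.inl ⟨rfl, rfl⟩⟩
  · rintro ⟨a, ha, ⟨rfl, rfl⟩ | ⟨rfl, rfl⟩⟩
    · exact ⟨rfl, Ne.symm ha⟩
    · exact ⟨hf.invol _, ha⟩

theorem isMaximumMatching_iff [Finite V] {G : SimpleGraph V} {M : G.Subgraph}
    (hM : M.IsMatching) {f : V → V} (hf : IsInv G f)
    (h : ∀ v w, M.Adj v w ↔ f v = w ∧ v ≠ w) : IsMaximumMatching G M ↔ IsMaxInv G f := by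
  have e := two_mul_ncard_edgeSet hf h
  constructor
  · intro hmax
    refine ⟨hf, fun g hg => ?_⟩
    obtain ⟨M', hM', h'⟩ := exists_isMatching_of_isInv hg
    have := hmax.2 M' hM'
    have e' := two_mul_ncard_edgeSet hg h'
    omega
  · intro hmax
    refine ⟨hM, fun M' hM' => ?_⟩
    obtain ⟨g, hg, h'⟩ := exists_isInv_of_isMatching hM'
    have := hmax.2 g hg
    have e' := two_mul_ncard_edgeSet hg h'
    omega

theorem mem_setD_iff [Finite V] {G : SimpleGraph V} {v : V} :
    v ∈ setD G ↔ ∃ f, IsMaxInv G f ∧ f v = v := by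
  constructor
  · rintro ⟨M, hM, hv⟩
    obtain ⟨f, hf, h⟩ := exists_isInv_of_isMatching hM.1
    exact ⟨f, (isMaximumMatching_iff hM.1 hf h).1 hM, by
      simpa using (mem_verts_iff hM.1 h).not.1 hv⟩
  · rintro ⟨f, hf, hv⟩
    obtain ⟨M, hM, h⟩ := exists_isMatching_of_isInv hf.1
    exact ⟨M, (isMaximumMatching_iff hM hf.1 h).2 hf, by
      rw [mem_verts_iff hM h]; simpa using hv⟩

theorem IsMaxInv.mem_setD [Finite V] {G : SimpleGraph V} {f : V → V} (hf : IsMaxInv G f) {v : V}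
    (h : f v = v) : v ∈ setD G :=
  mem_setD_iff.2 ⟨f, hf, h⟩

/-! ### Exchanging two matchings along a component of their union -/

/-- The union of two matchings. -/
def unionGraph {G : SimpleGraph V} {f g : V → V} (hf : IsInv G f) (hg : IsInv G g) :
    SimpleGraph V where
  Adj x y := x ≠ y ∧ (f x = y ∨ g x = y)
  symm := ⟨by
    rintro x y ⟨h, rfl | rfl⟩
    · exact ⟨h.symm, Or.inl (hf.invol x)⟩
    · exact ⟨h.symm, Or.inr (hg.invol x)⟩⟩
  loopless := ⟨fun x h => h.1 rfl⟩

section Component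

variable {G : SimpleGraph V} {f g : V → V} (hf : IsInv G f) (hg : IsInv G g)

theorem unionGraph_le : unionGraph hf hg ≤ G := by
  rintro x y ⟨h, rfl | rfl⟩
  · exact hf.adj x h.symm
  · exact hg.adj x h.symm

/-- The vertices of the component of `u` in the union of two matchings. -/
def comp (u : V) : Set V := {x | (unionGraph hf hg).Reachable u x}

theorem self_mem_comp (u : V) : u ∈ comp hf hg u := SimpleGraph.Reachable.refl u

theorem left_mem_comp {u x : V} (h : x ∈ comp hf hg u) : f x ∈ comp hf hg u := by
  by_cases hx : f x = x
  · rwa [hx]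
  · exact h.trans (SimpleGraph.Adj.reachable ⟨Ne.symm hx, Or.inl rfl⟩)

theorem right_mem_comp {u x : V} (h : x ∈ comp hf hg u) : g x ∈ comp hf hg u := by
  by_cases hx : g x = x
  · rwa [hx]
  · exact h.trans (SimpleGraph.Adj.reachable ⟨Ne.symm hx, Or.inr rfl⟩)

theorem isInv_swapOn_comp (u : V) : IsInv G (swapOn (comp hf hg u) f g) :=
  hf.swapOn (fun _ h => left_mem_comp hf hg h)
    fun v hv => ⟨right_mem_comp hf hg hv, hg.invol v, hg.adj v⟩

theorem isInv_swapOn_comp' (u : V) : IsInv G (swapOn (comp hf hg u) g f) :=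
  hg.swapOn (fun _ h => right_mem_comp hf hg h)
    fun v hv => ⟨left_mem_comp hf hg hv, hf.invol v, hf.adj v⟩

/-- A component of the union of two matchings has at most two ends. -/
theorem ncard_fix_inter_comp_add_le [Finite V] (u : V) :
    (fix f ∩ comp hf hg u).ncard + (fix g ∩ comp hf hg u).ncard ≤ 2 := by
  classical
  set P := comp hf hg u with hP
  let K := unionGraph hf hg
  have hconn : (K.induce P).Connected := by
    have := (K.connectedComponentMk u).connected_toSimpleGraph
    have hs : (K.connectedComponentMk u).supp = P := by
      ext x
      simp only [SimpleGraph.ConnectedComponent.mem_supp_iff, SimpleGraph.ConnectedComponent.eq]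
      exact ⟨fun h => h.symm, fun h => h.symm⟩
    rw [← hs]
    exact this
  -- Connectedness gives |P| ≤ |E| + 1, while each matching contributes half of the vertices of P
  -- that it covers; comparing the two leaves at most two missed ends.
  have h1 := hconn.card_vert_le_card_edgeSet_add_one
  have h2 : Nat.card (K.induce P).edgeSet ≤
      ((fun v => s(v, f v)) '' (P \ fix f)).ncard + ((fun v => s(v, g v)) '' (P \ fix g)).ncard := by
    refine le_trans ?_ (Set.ncard_union_le _ _)
    rw [Nat.card_coe_set_eq]
    refine Set.ncard_le_ncard_of_injOn (Sym2.map Subtype.val) ?_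
      (Sym2.map.injective Subtype.val_injective).injOn (Set.toFinite _)
    intro e he
    induction e with | _ x y
    obtain ⟨x, hx⟩ := x
    obtain ⟨y, hy⟩ := y
    obtain ⟨hne, rfl | rfl⟩ : x ≠ y ∧ (f x = y ∨ g x = y) := he
    · exact Or.inl ⟨x, ⟨hx, Ne.symm hne⟩, rfl⟩
    · exact Or.inr ⟨x, ⟨hx, Ne.symm hne⟩, rfl⟩
  have h3 := two_mul_ncard_edges (T := P \ fix f) (f := f) (by
    rintro v ⟨hv, hv'⟩
    refine ⟨⟨left_mem_comp hf hg hv, fun h => hv' ?_⟩, hf.invol v, hv'⟩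
    rw [mem_fix, hf.invol] at h; exact h.symm)
  have h4 := two_mul_ncard_edges (T := P \ fix g) (f := g) (by
    rintro v ⟨hv, hv'⟩
    refine ⟨⟨right_mem_comp hf hg hv, fun h => hv' ?_⟩, hg.invol v, hv'⟩
    rw [mem_fix, hg.invol] at h; exact h.symm)
  have h5 := Set.ncard_inter_add_ncard_sdiff_eq_ncard P (fix f)
  have h6 := Set.ncard_inter_add_ncard_sdiff_eq_ncard P (fix g)
  rw [Set.inter_comm] at h5 h6
  rw [Nat.card_coe_set_eq] at h1
  omega

/-- The edges of the path alternate between `f` and `g`, and a last edge is an `f`-edge because `g`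
misses the endpoint; the parity of the length is thus decided by the first edge. -/
theorem even_length_of_isPath {x v : V} (p : (unionGraph hf hg).Walk x v) (hp : p.IsPath)
    (hv : g v = v) :
    ((f x = x ∨ f x ∉ p.support) → Even p.length) ∧ (g x ∉ p.support → Odd p.length) := by
  induction p with
  | nil => exact ⟨fun _ => by simp, fun h => by simp [hv] at h⟩
  | @cons x y v h p ih =>
    rw [SimpleGraph.Walk.cons_isPath_iff] at hp
    obtain ⟨ih1, ih2⟩ := ih hp.1 hv
    rw [SimpleGraph.Walk.length_cons, SimpleGraph.Walk.support_cons]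
    have hy := p.start_mem_support
    obtain ⟨hne, hxy | hxy⟩ := id h
    · constructor
      · rintro (h | h)
        · exact (hne (h.symm.trans hxy)).elim
        · exact (h (by rw [hxy]; simp)).elim
      · intro _
        exact (ih1 (Or.inr (by rw [show f y = x from hxy ▸ hf.invol x]; exact hp.2))).add_one
    · constructor
      · intro _
        exact (ih2 (by rw [show g y = x from hxy ▸ hg.invol x]; exact hp.2)).add_one
      · intro h
        exact (h (by rw [hxy]; simp)).elim

end Component

theorem isInv_join {G : SimpleGraph V} {f : V → V} (hf : IsInv G f) {a w : V} (ha : f a = a)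
    (hw : f w = w) (haw : G.Adj a w) [DecidableEq V] :
    IsInv G (swapOn {a, w} f (Equiv.swap a w)) := by
  refine hf.swapOn ?_ ?_
  · rintro v (rfl | rfl) <;> simp [ha, hw]
  · rintro v (rfl | rfl) <;> simp [haw, haw.symm]

theorem ncard_fix_join [Finite V] {f : V → V} {a w : V} (ha : f a = a)
    (hw : f w = w) (haw : a ≠ w) [DecidableEq V] :
    (fix (swapOn {a, w} f (Equiv.swap a w))).ncard + 2 = (fix f).ncard := by
  rw [ncard_fix_swapOn, ncard_fix_split {a, w} f]
  have e1 : fix (Equiv.swap a w) ∩ {a, w} = ∅ := by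
    ext v
    simp only [Set.mem_inter_iff, mem_fix, Set.mem_insert_iff, Set.mem_singleton_iff,
      Set.mem_empty_iff_false, iff_false, not_and]
    rintro h (rfl | rfl) <;> simp at h <;> simp_all
  have e2 : fix f ∩ {a, w} = {a, w} := by
    rw [Set.inter_eq_right]
    rintro v (rfl | rfl) <;> assumption
  rw [e1, e2, Set.ncard_pair haw, Set.ncard_empty]

theorem isInv_unjoin {G : SimpleGraph V} {f : V → V} (hf : IsInv G f) (a : V) :
    IsInv G (swapOn {a, f a} f id) := by
  refine hf.swapOn ?_ ?_
  · rintro v (rfl | rfl) <;> simp [hf.invol]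
  · rintro v (rfl | rfl) <;> simp

theorem ncard_fix_unjoin [Finite V] {G : SimpleGraph V} {f : V → V} (hf : IsInv G f) {a : V}
    (ha : f a ≠ a) : (fix (swapOn {a, f a} f id)).ncard = (fix f).ncard + 2 := by
  rw [ncard_fix_swapOn, ncard_fix_split {a, f a} f]
  have e1 : fix f ∩ {a, f a} = ∅ := by
    ext v
    simp only [Set.mem_inter_iff, mem_fix, Set.mem_insert_iff, Set.mem_singleton_iff,
      Set.mem_empty_iff_false, iff_false, not_and]
    rintro h (rfl | rfl)
    · exact ha h
    · rw [hf.invol] at h; exact ha h.symm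
  have e2 : fix id ∩ {a, f a} = {a, f a} := by
    rw [Set.inter_eq_right]; intro v _; rfl
  rw [e1, e2, Set.ncard_pair ha.symm, Set.ncard_empty]

/-- A maximum matching misses no two adjacent vertices. -/
theorem IsMaxInv.not_adj [Finite V] {G : SimpleGraph V} {f : V → V} (hf : IsMaxInv G f) {a w : V}
    (ha : f a = a) (hw : f w = w) : ¬ G.Adj a w := by
  classical
  intro h
  have := hf.2 _ (isInv_join hf.1 ha hw h)
  have := ncard_fix_join ha hw h.ne
  omega

/-- An edge joining two vertices, each missed by some maximum matching, is in an odd cycle. -/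
theorem exists_odd_cycle_of_adj_setD [Finite V] {G : SimpleGraph V} {u v : V} (hu : u ∈ setD G)
    (hv : v ∈ setD G) (huv : G.Adj u v) : ∃ c : G.Walk v v, c.IsCycle ∧ Odd c.length := by
  obtain ⟨f, hf, hfu⟩ := mem_setD_iff.1 hu
  obtain ⟨g, hg, hgv⟩ := mem_setD_iff.1 hv
  set P := comp hf.1 hg.1 u with hP
  have hI1 : IsInv G (swapOn P f g) := isInv_swapOn_comp hf.1 hg.1 u
  have hI2 : IsInv G (swapOn P g f) := isInv_swapOn_comp' hf.1 hg.1 u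
  have h1 := hf.2 _ hI1
  have c1 := ncard_fix_swapOn P f g
  have c2 := ncard_fix_swapOn P g f
  have c3 := ncard_fix_split P f
  have c4 := ncard_fix_split P g
  -- Otherwise giving `g` the edges of `f` on P costs nothing, since `f` is maximum, and the result
  -- misses both adjacent vertices u and v.
  have hvP : v ∈ P := by
    by_contra hvP
    have h3 : IsMaxInv G (swapOn P g f) := hg.of_le hI2 (by omega)
    refine h3.not_adj (a := u) (w := v) ?_ ?_ huv
    · rwa [swapOn_of_mem (self_mem_comp _ _ u)]
    · rwa [swapOn_of_notMem hvP]
  obtain ⟨p, hp⟩ := SimpleGraph.Reachable.exists_isPath hvP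
  have hpe := (even_length_of_isPath hf.1 hg.1 p hp hgv).1 (Or.inl hfu)
  refine ⟨SimpleGraph.Walk.cons huv.symm (p.mapLe (unionGraph_le hf.1 hg.1)), ?_, ?_⟩
  · rw [SimpleGraph.Walk.cons_isCycle_iff]
    refine ⟨(SimpleGraph.Walk.isPath_mapLe _).2 hp, fun he => ?_⟩
    rw [SimpleGraph.Walk.edges_mapLe_eq_edges] at he
    have := p.adj_of_mem_edges he
    obtain ⟨hne, h | h⟩ := this.symm
    · exact hne (hfu.symm.trans h)
    · have := hg.1.invol u
      rw [h, hgv] at this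
      exact hne this.symm
  · simpa using hpe.add_one

/-- Maximum matchings match vertices of `A(G)` to vertices of `D(G)`. -/
theorem IsMaxInv.mem_setD_of_mem_setA [Finite V] {G : SimpleGraph V} {f : V → V}
    (hf : IsMaxInv G f) {a : V} (ha : a ∈ setA G) : f a ∈ setD G := by
  classical
  obtain ⟨⟨w, hw, haw⟩, haD⟩ := ha
  obtain ⟨g, hg, hgw⟩ := mem_setD_iff.1 hw
  have hfa : f a ≠ a := fun h => haD (hf.mem_setD h)
  by_contra hy
  set y := f a with hydef
  have hf0 : IsInv G (swapOn {a, y} f id) := isInv_unjoin hf.1 a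
  have hc0 : (fix (swapOn {a, y} f id)).ncard = (fix f).ncard + 2 := ncard_fix_unjoin hf.1 hfa
  set f0 := swapOn {a, y} f id
  have hfa0 : f0 a = a := swapOn_of_mem (by simp)
  have hfy0 : f0 y = y := swapOn_of_mem (by simp)
  have hyw : y ≠ w := fun h => hy (h ▸ hw)
  have hfg : (fix f).ncard = (fix g).ncard := le_antisymm (hf.2 g hg.1) (hg.2 f hf.1)
  set P := comp hf0 hg.1 y with hP
  have hyP : y ∈ P := self_mem_comp _ _ y
  have h2 := ncard_fix_inter_comp_add_le hf0 hg.1 y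
  rw [← hP] at h2
  have hI1 : IsInv G (swapOn P f0 g) := isInv_swapOn_comp hf0 hg.1 y
  have hI2 : IsInv G (swapOn P g f0) := isInv_swapOn_comp' hf0 hg.1 y
  have c1 := ncard_fix_swapOn P f0 g
  have c2 := ncard_fix_swapOn P g f0
  have c3 := ncard_fix_split P f0
  have c4 := ncard_fix_split P g
  -- If P contains a, then a and y are its only ends, so w is outside P; `g` with `f0` put on P
  -- misses a, w and y, and adding the edge aw makes it maximum again.
  by_cases haP : a ∈ P
  · have h3 : 2 ≤ (fix f0 ∩ P).ncard := by
      rw [← Set.ncard_pair hfa]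
      refine Set.ncard_le_ncard ?_
      rintro v (rfl | rfl)
      · exact ⟨hfy0, hyP⟩
      · exact ⟨hfa0, haP⟩
    have hwP : w ∉ P := by
      intro hwP
      have : 0 < (fix g ∩ P).ncard := (Set.ncard_pos).2 ⟨w, hgw, hwP⟩
      omega
    have ha2 : swapOn P g f0 a = a := by rw [swapOn_of_mem haP, hfa0]
    have hw2 : swapOn P g f0 w = w := by rw [swapOn_of_notMem hwP, hgw]
    have hI := isInv_join hI2 ha2 hw2 haw
    have c5 := ncard_fix_join ha2 hw2 haw.ne
    refine hy ((hg.of_le hI (by omega)).mem_setD ?_)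
    rw [swapOn_of_notMem, swapOn_of_mem hyP, hfy0]
    rintro (h | h)
    · exact hfa h
    · exact hyw h
  · by_cases hd : (fix f0 ∩ P).ncard ≤ (fix g ∩ P).ncard
    · refine hy ((hg.of_le hI2 (by omega)).mem_setD ?_)
      rw [swapOn_of_mem hyP, hfy0]
    -- Missed vertices have the parity of |V|, so the strict gain on P is at least two. It repays
    -- the removed edge, leaving a maximum matching that misses a.
    · have e1 := hI1.two_mul_ncard_add
      have e2 := hf0.two_mul_ncard_add
      refine haD ((hf.of_le hI1 (by omega)).mem_setD ?_)
      rw [swapOn_of_notMem haP, hfa0]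

/-! ### Rotating matchings along stems and odd cycles -/

/-- Exchanging along an even alternating path ending at a missed vertex. -/
theorem exists_isMaxInv_of_isAlternating [Finite V] {G : SimpleGraph V} {M : G.Subgraph}
    {f : V → V} (hf : IsMaxInv G f) (h : ∀ v w, M.Adj v w ↔ f v = w ∧ v ≠ w) :
    ∀ {b r : V} (p : G.Walk b r), f r = r → p.IsPath → Even p.length → IsAlternating M p →
      (∃ f', IsMaxInv G f' ∧ f' b = b ∧ ∀ v ∉ p.support, f' v = f v) ∧
      (∀ e ∈ p.edges.head?, e ∈ M.edgeSet) ∧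
      ∀ v ∈ p.support, v ∈ setD G ∨ ∃ w ∈ setD G, G.Adj v w
  | _, _, .nil, hr, _, _, _ =>
    ⟨⟨f, hf, hr, fun _ _ => rfl⟩, by simp, fun v hv => by
      simp only [SimpleGraph.Walk.support_nil, List.mem_singleton] at hv
      subst hv
      exact Or.inl (hf.mem_setD hr)⟩
  | _, _, .cons _ .nil, _, _, he, _ => by simp at he
  | x, r, .cons (v := y) hxy (.cons (v := z) hyz q), hr, hp, he, ha => by
    classical
    simp only [SimpleGraph.Walk.cons_isPath_iff, SimpleGraph.Walk.support_cons,
      List.mem_cons, not_or] at hp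
    obtain ⟨⟨hq, hyq⟩, hxy', hxq⟩ := hp
    have hzq := q.start_mem_support
    have hxz : x ≠ z := fun e => hxq (e ▸ hzq)
    have hyz' : y ≠ z := fun e => hyq (e ▸ hzq)
    have hqe : Even q.length := by
      simp only [SimpleGraph.Walk.length_cons] at he
      rw [Nat.even_iff] at he ⊢
      omega
    simp only [IsAlternating, SimpleGraph.Walk.edges_cons, List.isChain_cons_cons] at ha
    have hqa : IsAlternating M q := by
      have := ha.2.tail
      rwa [List.tail_cons] at this
    obtain ⟨⟨f1, hf1, hz1, hag⟩, hhead, hD⟩ :=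
      exists_isMaxInv_of_isAlternating hf h q hr hq hqe hqa
    -- Either z is the missed root, or the first edge of the rest of the path is in `M` and
    -- alternation excludes yz.
    have hyzM : s(y, z) ∉ M.edgeSet := by
      cases hqs : q.edges with
      | nil =>
        have hzr : z = r := SimpleGraph.Walk.eq_of_length_eq_zero (p := q) (by
          rw [← SimpleGraph.Walk.length_edges, hqs, List.length_nil])
        intro hm
        rw [SimpleGraph.Subgraph.mem_edgeSet] at hm
        have := (h z y).1 hm.symm
        rw [hzr, hr] at this
        exact hyz' (this.1.symm.trans hzr.symm)
      | cons e l =>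
        rw [hqs] at hhead
        have h2 := ha.2
        rw [hqs, List.isChain_cons_cons] at h2
        intro hm
        exact h2.1.1 hm (hhead e (by simp))
    have hxyM := ha.1.2 hyzM
    have hfx : f x = y := ((h x y).1 hxyM).1
    have hfx1 : f1 x = y := by rw [hag x hxq, hfx]
    have hfy1 : f1 y = x := by rw [← hfx1, hf1.1.invol]
    -- The recursive matching misses z and still contains xy; replacing xy by yz moves the missed
    -- vertex from z to x.
    have hI : IsInv G (swapOn {x, y, z} f1 (Equiv.swap y z)) := by
      refine hf1.1.swapOn ?_ ?_
      · rintro v (rfl | rfl | rfl)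
        · rw [hfx1]; simp
        · rw [hfy1]; simp
        · rw [hz1]; simp
      · rintro v (rfl | rfl | rfl)
        · simp [Equiv.swap_apply_of_ne_of_ne hxy' hxz]
        · simp [hyz]
        · simp [hyz.symm]
    have e1 : fix f1 ∩ {x, y, z} = {z} := by
      ext v
      simp only [Set.mem_inter_iff, mem_fix, Set.mem_insert_iff, Set.mem_singleton_iff]
      constructor
      · rintro ⟨hv, rfl | rfl | rfl⟩
        · exact (hxy' (hv.symm.trans hfx1)).elim
        · exact (hxy' (hfy1.symm.trans hv)).elim
        · rfl
      · rintro rfl; simp [hz1]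
    have e2 : fix (Equiv.swap y z) ∩ {x, y, z} = {x} := by
      ext v
      simp only [Set.mem_inter_iff, mem_fix, Set.mem_insert_iff, Set.mem_singleton_iff]
      constructor
      · rintro ⟨hv, rfl | rfl | rfl⟩
        · rfl
        · rw [Equiv.swap_apply_left] at hv; exact (hyz' hv.symm).elim
        · rw [Equiv.swap_apply_right] at hv; exact (hyz' hv).elim
      · rintro rfl; simp [Equiv.swap_apply_of_ne_of_ne hxy' hxz]
    have hmax : IsMaxInv G (swapOn {x, y, z} f1 (Equiv.swap y z)) := hf1.of_le hI (by
      rw [ncard_fix_swapOn, ncard_fix_split {x, y, z} f1, e1, e2, Set.ncard_singleton,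
        Set.ncard_singleton])
    have hx' : swapOn {x, y, z} f1 (Equiv.swap y z) x = x := by
      rw [swapOn_of_mem (by simp), Equiv.swap_apply_of_ne_of_ne hxy' hxz]
    refine ⟨⟨_, hmax, hx', ?_⟩, ?_, ?_⟩
    · intro v hv
      simp only [SimpleGraph.Walk.support_cons, List.mem_cons, not_or] at hv
      rw [swapOn_of_notMem, hag v hv.2.2]
      rintro (e | e | e)
      · exact hv.1 e
      · exact hv.2.1 e
      · exact hv.2.2 (e ▸ hzq)
    · simpa using hxyM
    · intro v hv
      simp only [SimpleGraph.Walk.support_cons, List.mem_cons] at hv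
      obtain rfl | rfl | hv := hv
      · exact Or.inl (hmax.mem_setD hx')
      · exact Or.inr ⟨z, hf1.mem_setD hz1, hyz⟩
      · exact hD v hv

/-- The vertices of a path of even length other than its last vertex can be matched. -/
theorem exists_near_perfect_of_isPath {G : SimpleGraph V} :
    ∀ {x w : V} (q : G.Walk x w), q.IsPath → Even q.length →
      ∃ g : V → V, ∀ v ∈ q.support,
        g v ∈ q.support ∧ g (g v) = v ∧ (g v ≠ v → G.Adj v (g v)) ∧ (g v = v ↔ v = w)
  | _, _, .nil, _, _ => ⟨id, fun v hv => by simpa using hv⟩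
  | _, _, .cons _ .nil, _, he => by simp at he
  | x, w, .cons (v := y) hxy (.cons (v := z) hyz q), hp, he => by
    classical
    simp only [SimpleGraph.Walk.cons_isPath_iff, SimpleGraph.Walk.support_cons,
      List.mem_cons, not_or] at hp
    obtain ⟨⟨hq, hyq⟩, hxy', hxq⟩ := hp
    have hqe : Even q.length := by
      simp only [SimpleGraph.Walk.length_cons] at he
      rw [Nat.even_iff] at he ⊢
      omega
    obtain ⟨g, hg⟩ := exists_near_perfect_of_isPath q hq hqe
    have hxw : x ≠ w := fun e => hxq (e ▸ q.end_mem_support)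
    have hyw : y ≠ w := fun e => hyq (e ▸ q.end_mem_support)
    have ex : swapOn {x, y} g (Equiv.swap x y) x = y := by rw [swapOn_of_mem (by simp)]; simp
    have ey : swapOn {x, y} g (Equiv.swap x y) y = x := by rw [swapOn_of_mem (by simp)]; simp
    have eq : ∀ v ∈ q.support, swapOn {x, y} g (Equiv.swap x y) v = g v := by
      intro v hv
      refine swapOn_of_notMem ?_
      rintro (rfl | rfl)
      · exact hxq hv
      · exact hyq hv
    refine ⟨swapOn {x, y} g (Equiv.swap x y), fun v hv => ?_⟩
    simp only [SimpleGraph.Walk.support_cons, List.mem_cons] at hv ⊢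
    obtain rfl | rfl | hv := hv
    · simp [ex, ey, hxy, Ne.symm hxy', hxw]
    · simp [ex, ey, hxy.symm, hxy', hyw]
    · obtain ⟨h1, h2, h3, h4⟩ := hg v hv
      rw [eq v hv, eq _ h1]
      exact ⟨Or.inr (Or.inr h1), h2, h3, h4⟩

/-- An odd cycle minus one of its vertices has a perfect matching. -/
theorem exists_near_perfect_of_isCycle {G : SimpleGraph V} {b : V} (c : G.Walk b b)
    (hc : c.IsCycle) (ho : Odd c.length) {w : V} (hw : w ∈ c.support) :
    ∃ g : V → V, ∀ v ∈ c.support,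
      g v ∈ c.support ∧ g (g v) = v ∧ (g v ≠ v → G.Adj v (g v)) ∧ (g v = v ↔ v = w) := by
  classical
  have hc' := hc.rotate hw
  have hl : (c.rotate w hw).length = c.length := by simp
  have hs : ∀ v, v ∈ (c.rotate w hw).support ↔ v ∈ c.support := fun v =>
    SimpleGraph.Walk.mem_support_rotate_iff ..
  rw [← hl] at ho
  simp only [← hs]
  generalize c.rotate w hw = d at *
  cases d with
  | nil => simp at ho
  | cons h q =>
    rw [SimpleGraph.Walk.cons_isCycle_iff] at hc'
    rw [SimpleGraph.Walk.length_cons] at ho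
    have hqe : Even q.length := by
      rw [Nat.odd_iff] at ho; rw [Nat.even_iff]; omega
    obtain ⟨g, hg⟩ := exists_near_perfect_of_isPath q hc'.1 hqe
    refine ⟨g, fun v hv => ?_⟩
    have hv' : v ∈ q.support := by
      rw [SimpleGraph.Walk.support_cons, List.mem_cons] at hv
      rcases hv with rfl | hv
      · exact q.end_mem_support
      · exact hv
    obtain ⟨h1, h2⟩ := hg v hv'
    exact ⟨by rw [SimpleGraph.Walk.support_cons]; exact List.mem_cons_of_mem _ h1, h2⟩

theorem ncard_support_of_isCycle {G : SimpleGraph V} {b : V} (c : G.Walk b b)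
    (hc : c.IsCycle) : {v | v ∈ c.support}.ncard = c.length := by
  classical
  cases c with
  | nil => simp at hc
  | cons h q =>
    rw [SimpleGraph.Walk.cons_isCycle_iff] at hc
    have : {v | v ∈ (SimpleGraph.Walk.cons h q).support} = (q.support.toFinset : Set V) := by
      ext v
      simp only [SimpleGraph.Walk.support_cons, List.mem_cons, Set.mem_ofPred_eq,
        List.coe_toFinset, or_iff_right_iff_imp]
      rintro rfl
      exact q.end_mem_support
    rw [this, Set.ncard_coe_finset, List.toFinset_card_of_nodup hc.1.support_nodup,
      SimpleGraph.Walk.length_support, SimpleGraph.Walk.length_cons]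

/-- The matching of a blossom matches its vertices other than the base among themselves. -/
theorem IsBlossom.mem_support [Finite V] {G : SimpleGraph V} {M : G.Subgraph} {f : V → V}
    (hf : IsInv G f) (h : ∀ v w, M.Adj v w ↔ f v = w ∧ v ≠ w) {b : V} {c : G.Walk b b}
    (hb : IsBlossom M c) {v : V} (hv : v ∈ c.support) (hvb : v ≠ b) :
    f v ∈ c.support ∧ f v ≠ v ∧ f v ≠ b := by
  obtain ⟨hc, ⟨k, hk, hkM⟩, hbase⟩ := hb
  -- T consists of the ends of the k matching edges on the cycle. It has 2k elements and avoids the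
  -- base, hence is the whole cycle minus the base.
  set T : Set V := {v | s(v, f v) ∈ c.edges ∧ f v ≠ v} with hT
  have hTf : ∀ v ∈ T, f v ∈ T ∧ f (f v) = v ∧ f v ≠ v := by
    rintro v ⟨h1, h2⟩
    refine ⟨⟨?_, ?_⟩, hf.invol v, h2⟩
    · rwa [hf.invol, Sym2.eq_swap]
    · rw [hf.invol]; exact h2.symm
  have h2 := two_mul_ncard_edges hTf
  have e1 : (fun v => s(v, f v)) '' T = {e | e ∈ c.edges ∧ e ∈ M.edgeSet} := by
    ext e
    constructor
    · rintro ⟨v, hv, rfl⟩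
      exact ⟨hv.1, (h v (f v)).2 ⟨rfl, hv.2.symm⟩⟩
    · induction e with | _ x y
      rintro ⟨hc, hm⟩
      obtain ⟨rfl, hne⟩ := (h x y).1 hm
      exact ⟨x, ⟨hc, hne.symm⟩, rfl⟩
  rw [e1, hkM] at h2
  have hTs : T ⊆ {v | v ∈ c.support} \ {b} := by
    rintro v ⟨h1, hne⟩
    refine ⟨c.fst_mem_support_of_mem_edges h1, ?_⟩
    rintro rfl
    exact hbase _ h1 ((h v (f v)).2 ⟨rfl, hne.symm⟩) (Sym2.mem_mk_left _ _)
  have hcard : ({v | v ∈ c.support} \ {b}).ncard = 2 * k := by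
    rw [Set.ncard_sdiff_singleton_of_mem (by simp), ncard_support_of_isCycle c hc, hk]
    rfl
  have hTe : T = {v | v ∈ c.support} \ {b} :=
    Set.eq_of_subset_of_ncard_le hTs (by rw [hcard, h2])
  have hvT : v ∈ T := hTe ▸ ⟨hv, hvb⟩
  have hfv := (hTf v hvT).1
  rw [hTe] at hfv
  exact ⟨hfv.1, hvT.2, hfv.2⟩

/-! ### The odd cycle of an almost bipartite part -/

/-- The structure of an almost bipartite graph covered by the flowers of its odd cycle. -/
theorem exists_cycle_structure [Finite V] {G : SimpleGraph V} (hG : IsAlmostBipartite G)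
    (hR : ∀ C : G.Subgraph, IsOddCycle G C → reachSet G C = Set.univ) :
    ∃ Y : Set V, (∃ x y, x ∈ Y ∧ y ∈ Y ∧ x ≠ y) ∧
      (∀ u ∈ setD G, ∀ v ∈ setD G, G.Adj u v → u ∈ Y) ∧
      (∀ w ∈ Y, ∃ f, IsMaxInv G f ∧ f w = w ∧ ∀ v ∈ Y, f v ∈ Y ∧ (f v = v → v = w)) ∧
      ∀ v, v ∈ setD G ∨ v ∈ setA G := by
  obtain ⟨C, hC, hCu⟩ := hG
  have hR := hR C hC
  have key : ∀ v, ∃ (M : G.Subgraph) (f : V → V) (b r : V) (c : G.Walk b b) (p : G.Walk b r),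
      IsMaxInv G f ∧ (∀ v w, M.Adj v w ↔ f v = w ∧ v ≠ w) ∧ f r = r ∧ IsFlower M c p ∧
      c.toSubgraph = C ∧ (v ∈ c.support ∨ v ∈ p.support) := by
    intro v
    obtain ⟨M, hM, b, r, c, p, hfl, hcC, hv⟩ : v ∈ reachSet G C := by rw [hR]; trivial
    obtain ⟨f, hf, h⟩ := exists_isInv_of_isMatching hM.1
    refine ⟨M, f, b, r, c, p, (isMaximumMatching_iff hM.1 hf h).1 hM, h, ?_, hfl, hcC, hv⟩
    by_contra hr
    exact hfl.2.2.2.2.1 ((mem_verts_iff hM.1 h).2 hr)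
  have hmatch : ∀ w ∈ C.verts, ∃ f, IsMaxInv G f ∧ f w = w ∧
      ∀ v ∈ C.verts, f v ∈ C.verts ∧ (f v = v → v = w) := by
    intro w hw
    -- Any one flower suffices: exchanging along its stem frees the base, then rematching the cycle
    -- frees w instead.
    obtain ⟨M, f, b, r, c, p, hf, h, hr, ⟨hbl, hpp, hpe, hpa, -, hcp⟩, hcC, -⟩ := key w
    obtain ⟨⟨f1, hf1, hb1, hag⟩, -, -⟩ :=
      exists_isMaxInv_of_isAlternating hf h p hr hpp hpe hpa
    have hCs : ∀ v, v ∈ C.verts ↔ v ∈ c.support := fun v => by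
      rw [← hcC, SimpleGraph.Walk.mem_verts_toSubgraph]
    obtain ⟨g, hg⟩ := exists_near_perfect_of_isCycle c hbl.1 (by
      obtain ⟨k, hk, -⟩ := hbl.2.1; exact ⟨k, hk⟩) ((hCs w).1 hw)
    simp only [← hCs] at hg
    have hf1C : ∀ v ∈ C.verts, v ≠ b → f1 v ∈ C.verts ∧ f1 v ≠ v := by
      intro v hv hvb
      rw [hCs] at hv
      rw [hag v (fun hvp => hvb (hcp v hv hvp)), hCs]
      have := hbl.mem_support hf.1 h hv hvb
      exact ⟨this.1, this.2.1⟩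
    have hbC : b ∈ C.verts := (hCs b).2 c.start_mem_support
    have hI : IsInv G (swapOn C.verts f1 g) := hf1.1.swapOn (fun v hv => by
      by_cases hvb : v = b
      · subst hvb; rwa [hb1]
      · exact (hf1C v hv hvb).1) (fun v hv =>
        ⟨(hg v hv).1, (hg v hv).2.1, (hg v hv).2.2.1⟩)
    have e1 : fix f1 ∩ C.verts = {b} := by
      ext v
      simp only [Set.mem_inter_iff, mem_fix, Set.mem_singleton_iff]
      constructor
      · rintro ⟨h1, h2⟩
        by_contra hvb
        exact (hf1C v h2 hvb).2 h1
      · rintro rfl; exact ⟨hb1, hbC⟩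
    have e2 : fix g ∩ C.verts = {w} := by
      ext v
      simp only [Set.mem_inter_iff, mem_fix, Set.mem_singleton_iff]
      constructor
      · rintro ⟨h1, h2⟩
        exact (hg v h2).2.2.2.1 h1
      · rintro rfl; exact ⟨(hg v hw).2.2.2.2 rfl, hw⟩
    refine ⟨_, hf1.of_le hI (by
      rw [ncard_fix_swapOn, ncard_fix_split C.verts f1, e1, e2, Set.ncard_singleton,
        Set.ncard_singleton]), ?_, fun v hv => ?_⟩
    · rw [swapOn_of_mem hw]; exact (hg w hw).2.2.2.2 rfl
    · rw [swapOn_of_mem hv]; exact ⟨(hg v hv).1, (hg v hv).2.2.2.1⟩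
  have hCD : ∀ w ∈ C.verts, w ∈ setD G := fun w hw => by
    obtain ⟨f, hf, hfw, -⟩ := hmatch w hw
    exact hf.mem_setD hfw
  refine ⟨C.verts, ?_, ?_, hmatch, ?_⟩
  · obtain ⟨v, c, hc, -, rfl⟩ := hC
    refine ⟨v, c.snd, c.start_mem_verts_toSubgraph, ?_, (c.adj_snd hc.not_nil).ne⟩
    rw [SimpleGraph.Walk.mem_verts_toSubgraph]
    exact c.getVert_mem_support 1
  · intro u hu v hv huv
    -- The odd cycle through u must be C, by uniqueness.
    obtain ⟨c, hc, ho⟩ := exists_odd_cycle_of_adj_setD hv hu huv.symm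
    rw [← hCu _ ⟨u, c, hc, ho, rfl⟩]
    exact c.start_mem_verts_toSubgraph
  · intro v
    by_cases hvD : v ∈ setD G
    · exact Or.inl hvD
    refine Or.inr ?_
    obtain ⟨M, f, b, r, c, p, hf, h, hr, ⟨hbl, hpp, hpe, hpa, -, hcp⟩, hcC, hv⟩ := key v
    rcases hv with hv | hv
    · exact (hvD (hCD v (by rwa [← hcC, SimpleGraph.Walk.mem_verts_toSubgraph]))).elim
    · rcases (exists_isMaxInv_of_isAlternating hf h p hr hpp hpe hpa).2.2 v hv with h | h
      · exact (hvD h).elim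
      · exact ⟨h, hvD⟩

theorem not_adj_setD_of_isBipartite [Finite V] {G : SimpleGraph V} (hG : G.IsBipartite) {u v : V}
    (hu : u ∈ setD G) (hv : v ∈ setD G) : ¬ G.Adj u v := fun h => by
  obtain ⟨c, -, ho⟩ := exists_odd_cycle_of_adj_setD hu hv h
  exact Nat.not_even_iff_odd.2 ho (SimpleGraph.two_colorable_iff_forall_loop_even.1 hG _ c)

theorem IsInv.injective {G : SimpleGraph V} {f : V → V} (hf : IsInv G f) :
    Function.Injective f :=
  Function.Involutive.injective hf.invol

theorem IsInv.mono {G G' : SimpleGraph V} (h : G' ≤ G) {f : V → V} (hf : IsInv G' f) :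
    IsInv G f :=
  ⟨hf.invol, fun v hv => h (hf.adj v hv)⟩

/-! ### Cycle decompositions and the set D(G) -/

/-- The matching `F` leaves out exactly the vertex `w i` of each `Y i`, and matches the others
inside `Y i`. -/
def IsTransversalMatching {ι : Type*} (Y : ι → Set V) (w : ι → V) (F : V → V) : Prop :=
  ∀ i, F (w i) = w i ∧ ∀ v ∈ Y i, F v ∈ Y i ∧ (F v = v → v = w i)

/-- A spanning subgraph `G'` of `G` containing the edges at `D(G')`, in which the components of
`G'[D(G')]` with an edge span the sets `Y i`, any vertex of which can be missed. -/
structure IsCycleDecomp {ι : Type*} (G G' : SimpleGraph V) (Y : ι → Set V) : Prop where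
  le : G' ≤ G
  adj : ∀ u ∈ setD G', ∀ v, G.Adj u v → G'.Adj u v
  disj : ∀ i j v, v ∈ Y i → v ∈ Y j → i = j
  two : ∀ i, ∃ x y, x ∈ Y i ∧ y ∈ Y i ∧ x ≠ y
  edge : ∀ u ∈ setD G', ∀ v ∈ setD G', G'.Adj u v → ∃ i, u ∈ Y i ∧ v ∈ Y i
  exists_matching : ∀ w : ι → V, (∀ i, w i ∈ Y i) →
    ∃ F, IsMaxInv G' F ∧ IsTransversalMatching Y w F

/-- The vertices of `D(G)` with no neighbour in `D(G)`. -/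
def isoD (G : SimpleGraph V) : Set V := {v | v ∈ setD G ∧ ∀ u ∈ setD G, ¬ G.Adj v u}

theorem mem_setA_of_adj {G : SimpleGraph V} {u v : V} (hu : u ∈ isoD G) (h : G.Adj u v) :
    v ∈ setA G :=
  ⟨⟨u, hu.1, h.symm⟩, fun hv => hu.2 v hv h⟩

namespace IsCycleDecomp

variable {ι : Type*} {G G' : SimpleGraph V} {Y : ι → Set V}

theorem exists_transversal_ne (h : IsCycleDecomp G G' Y) (i : ι) (x : V) :
    ∃ w : ι → V, (∀ j, w j ∈ Y j) ∧ w i ≠ x := by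
  choose a b ha hb hab using h.two
  by_cases hx : a i = x
  · exact ⟨b, hb, fun e => hab i (hx.trans e.symm)⟩
  · exact ⟨a, ha, hx⟩

theorem exists_transversal (h : IsCycleDecomp G G' Y) : ∃ w : ι → V, ∀ i, w i ∈ Y i := by
  choose a b ha hb hab using h.two
  exact ⟨a, ha⟩

theorem mem_isoD (h : IsCycleDecomp G G' Y) {x : V} (hx : x ∈ setD G') (hY : ∀ i, x ∉ Y i) :
    x ∈ isoD G' :=
  ⟨hx, fun u hu hxu => by
    obtain ⟨i, hi, -⟩ := h.edge x hx u hu hxu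
    exact hY i hi⟩

theorem injective_transversal {w : ι → V} (h : IsCycleDecomp G G' Y) (hw : ∀ i, w i ∈ Y i) :
    Function.Injective w := fun i j e => h.disj i j (w i) (hw i) (e ▸ hw j)

theorem notMem_cycle {w : ι → V} {F : V → V} (hF : IsInv G' F) (hFw : IsTransversalMatching Y w F) {i : ι} {v : V}
    (hv : v ∉ Y i) : F v ∉ Y i :=
  hF.mapsTo_compl (fun u hu => ((hFw i).2 u hu).1) hv

theorem apply_mem_setA {F : V → V} (hF : IsInv G' F) {x : V} (hx : x ∈ isoD G') (hne : F x ≠ x) :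
    F x ∈ setA G' :=
  mem_setA_of_adj hx (hF.adj x hne)

variable [Finite V]

theorem subset_setD (h : IsCycleDecomp G G' Y) (i : ι) : Y i ⊆ setD G' := by
  classical
  intro x hx
  obtain ⟨w, hw, -⟩ := h.exists_transversal_ne i x
  obtain ⟨F, hF, hFw⟩ := h.exists_matching (Function.update w i x) (fun j => by
    by_cases hj : j = i
    · subst hj; simpa using hx
    · simpa [hj] using hw j)
  have := (hFw i).1
  simp only [Function.update_self] at this
  exact hF.mem_setD this

theorem exists_adj (h : IsCycleDecomp G G' Y) {i : ι} {x : V} (hx : x ∈ Y i) :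
    ∃ y ∈ Y i, G'.Adj x y := by
  obtain ⟨w, hw, hwx⟩ := h.exists_transversal_ne i x
  obtain ⟨F, hF, hFw⟩ := h.exists_matching w hw
  obtain ⟨h1, h2⟩ := (hFw i).2 x hx
  exact ⟨F x, h1, hF.1.adj x fun e => hwx (h2 e).symm⟩

theorem notMem_isoD (h : IsCycleDecomp G G' Y) {i : ι} {x : V} (hx : x ∈ Y i) : x ∉ isoD G' := by
  intro hX
  obtain ⟨y, hy, hxy⟩ := h.exists_adj hx
  exact hX.2 y (h.subset_setD i hy) hxy

section Matching

variable {w : ι → V} {F : V → V}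

theorem apply_mem_isoD (h : IsCycleDecomp G G' Y) (hF : IsMaxInv G' F)
    (hFw : IsTransversalMatching Y w F) {a : V} (ha : a ∈ setA G') : F a ∈ isoD G' :=
  h.mem_isoD (hF.mem_setD_of_mem_setA ha) fun i =>
    notMem_cycle hF.1 hFw fun hai => ha.2 (h.subset_setD i hai)

theorem apply_mem_setC (hF : IsMaxInv G' F) {c : V} (hc : c ∈ setC G') :
    F c ≠ c ∧ F c ∈ setC G' := by
  have hne : F c ≠ c := fun e => hc (Or.inl (hF.mem_setD e))
  refine ⟨hne, ?_⟩
  rintro (hD | hA)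
  · exact hc (Or.inr ⟨⟨F c, hD, hF.1.adj c hne⟩, fun hcD => hc (Or.inl hcD)⟩)
  · have := hF.mem_setD_of_mem_setA hA
    rw [hF.1.invol] at this
    exact hc (Or.inl this)

theorem fix_eq (h : IsCycleDecomp G G' Y) (hF : IsMaxInv G' F)
    (hFw : IsTransversalMatching Y w F) : fix F = (fix F ∩ isoD G') ∪ Set.range w := by
  ext v
  constructor
  · intro hv
    by_cases hY : ∃ i, v ∈ Y i
    · obtain ⟨i, hi⟩ := hY
      exact Or.inr ⟨i, (((hFw i).2 v hi).2 hv).symm⟩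
    · push Not at hY
      exact Or.inl ⟨hv, h.mem_isoD (hF.mem_setD hv) hY⟩
  · rintro (hv | ⟨i, rfl⟩)
    · exact hv.1
    · exact (hFw i).1

/-- `F` maps A bijectively onto the vertices of X that it covers. -/
theorem ncard_fix_inter_isoD_add (h : IsCycleDecomp G G' Y) (hF : IsMaxInv G' F)
    (hFw : IsTransversalMatching Y w F) :
    (fix F ∩ isoD G').ncard + (setA G').ncard = (isoD G').ncard := by
  have e : F '' setA G' = isoD G' \ fix F := by
    ext x
    constructor
    · rintro ⟨a, ha, rfl⟩
      refine ⟨h.apply_mem_isoD hF hFw ha, fun e => ha.2 ?_⟩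
      rw [mem_fix, hF.1.invol] at e
      exact hF.mem_setD e.symm
    · rintro ⟨hx, hne⟩
      exact ⟨F x, apply_mem_setA hF.1 hx hne, hF.1.invol x⟩
  rw [← Set.ncard_image_of_injective (setA G') hF.1.injective, e, Set.inter_comm]
  exact Set.ncard_inter_add_ncard_sdiff_eq_ncard _ _

theorem ncard_isoD_union_range (h : IsCycleDecomp G G' Y) (hw : ∀ i, w i ∈ Y i) {S : Set V}
    (hS : S ⊆ isoD G') : (S ∪ Set.range w).ncard = S.ncard + Nat.card ι := by
  rw [Set.ncard_union_eq, Set.ncard_range_of_injective (h.injective_transversal hw)]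
  rw [Set.disjoint_left]
  rintro _ hv ⟨i, rfl⟩
  exact h.notMem_isoD (hw i) (hS hv)

theorem ncard_fix_add (h : IsCycleDecomp G G' Y) (hF : IsMaxInv G' F) (hw : ∀ i, w i ∈ Y i)
    (hFw : IsTransversalMatching Y w F) :
    (fix F).ncard + (setA G').ncard = (isoD G').ncard + Nat.card ι := by
  have := h.ncard_fix_inter_isoD_add hF hFw
  rw [h.fix_eq hF hFw, h.ncard_isoD_union_range hw Set.inter_subset_right]
  omega

end Matching

/-- The cycles being odd, no matching of `G` matches one of them within itself. -/
theorem exists_transversal_of_isInv (h : IsCycleDecomp G G' Y) {g : V → V} (hg : IsInv G g) :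
    ∃ r : ι → V, (∀ i, r i ∈ Y i) ∧ ∀ i, g (r i) = r i ∨ g (r i) ∈ setA G' := by
  have key : ∀ i, ∃ v ∈ Y i, g v = v ∨ g v ∈ setA G' := by
    intro i
    by_contra! hcon
    -- Under the contrary assumption `g` pairs `Y i` within itself, so |Y i| is even; `F` pairs all
    -- of it but one vertex, so |Y i| is odd.
    have h1 := two_mul_ncard_edges (T := Y i) (f := g) (fun v hv => by
      obtain ⟨hne, hA⟩ := hcon v hv
      refine ⟨?_, hg.invol v, hne⟩
      have hvD := h.subset_setD i hv
      have hadj := h.adj v hvD _ (hg.adj v hne)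
      have hgD : g v ∈ setD G' := by
        by_contra hgD
        exact hA ⟨⟨v, hvD, hadj.symm⟩, hgD⟩
      obtain ⟨j, hj1, hj2⟩ := h.edge v hvD _ hgD hadj
      rwa [h.disj i j v hv hj1])
    obtain ⟨x, -, -⟩ := h.two i
    obtain ⟨w, hw, -⟩ := h.exists_transversal_ne i x
    obtain ⟨F, hF, hFw⟩ := h.exists_matching w hw
    have h2 := two_mul_ncard_edges (T := Y i \ {w i}) (f := F) (fun v hv => by
      obtain ⟨h1, h2⟩ := (hFw i).2 v hv.1
      refine ⟨⟨h1, fun e => hv.2 ?_⟩, hF.1.invol v, fun e => hv.2 (h2 e)⟩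
      rw [Set.mem_singleton_iff] at e ⊢
      rw [← hF.1.invol v, e, (hFw i).1])
    have h3 := Set.ncard_sdiff_singleton_add_one (hw i)
    omega
  choose r hr hr' using key
  exact ⟨r, hr, hr'⟩

/-- R consists of X and one vertex per cycle, each missed by `g` or matched into A. At most |A| of
them can be matched, which bounds the number missed from below for every matching of `G`, not only
of `G'`. -/
theorem exists_reps (h : IsCycleDecomp G G' Y) {g : V → V} (hg : IsInv G g) :
    ∃ R ⊆ setD G', (isoD G').ncard + Nat.card ι ≤ (fix g ∩ R).ncard + (setA G').ncard := by
  obtain ⟨r, hr, hgr⟩ := h.exists_transversal_of_isInv hg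
  refine ⟨isoD G' ∪ Set.range r, ?_, ?_⟩
  · rintro v (hv | ⟨i, rfl⟩)
    · exact hv.1
    · exact h.subset_setD i (hr i)
  · rw [← h.ncard_isoD_union_range hr subset_rfl,
      ← Set.ncard_inter_add_ncard_sdiff_eq_ncard (isoD G' ∪ Set.range r) (fix g), Set.inter_comm]
    refine Nat.add_le_add_left (Set.ncard_le_ncard_of_injOn g ?_ hg.injective.injOn) _
    rintro v ⟨hv | ⟨i, rfl⟩, hne⟩
    · exact mem_setA_of_adj hv (h.adj v hv.1 _ (hg.adj v hne))
    · exact (hgr i).resolve_left hne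

/-- A transversal matching attains the bound of `exists_reps`, so it is maximum in `G` too. For any
maximum `g` of `G` equality holds, hence all vertices that `g` misses lie in R ⊆ D(G'). -/
theorem setD_eq (h : IsCycleDecomp G G' Y) : setD G = setD G' := by
  obtain ⟨w, hw⟩ := h.exists_transversal
  obtain ⟨F, hF, hFw⟩ := h.exists_matching w hw
  have hc := h.ncard_fix_add hF hw hFw
  have hFG : IsMaxInv G F := ⟨hF.1.mono h.le, fun g hg => by
    obtain ⟨R, -, hR⟩ := h.exists_reps hg
    have : (fix g ∩ R).ncard ≤ (fix g).ncard := Set.ncard_le_ncard Set.inter_subset_left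
    omega⟩
  ext v
  constructor
  · intro hv
    obtain ⟨g, hg, hgv⟩ := mem_setD_iff.1 hv
    obtain ⟨R, hRD, hR⟩ := h.exists_reps hg.1
    have h1 := hg.2 F hFG.1
    have h2 : fix g ∩ R = fix g :=
      Set.eq_of_subset_of_ncard_le Set.inter_subset_left (by omega)
    have : v ∈ fix g ∩ R := by rw [h2]; exact hgv
    exact hRD this.2
  · intro hv
    obtain ⟨f, hf, hfv⟩ := mem_setD_iff.1 hv
    exact (hFG.of_le (hf.1.mono h.le) (hf.2 F hF.1)).mem_setD hfv

theorem isolatedD_eq (h : IsCycleDecomp G G' Y) : isolatedD G = isoD G' := by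
  ext v
  rw [isolatedD, Set.mem_image]
  constructor
  · rintro ⟨⟨u, hu⟩, hiso, rfl⟩
    refine ⟨h.setD_eq ▸ hu, fun x hx hux => hiso ⟨x, h.setD_eq ▸ hx⟩ ?_⟩
    exact h.le hux
  · rintro ⟨hv, hiso⟩
    refine ⟨⟨v, h.setD_eq ▸ hv⟩, ?_, rfl⟩
    rintro ⟨x, hx⟩ hvx
    exact hiso x (h.setD_eq ▸ hx) (h.adj v hv x hvx)

end IsCycleDecomp

/-! ### Critical independent sets -/

theorem IsInv.image_subset_nbhd {G : SimpleGraph V} {F : V → V} (hF : IsInv G F) (S : Set V) :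
    F '' (S \ fix F) ⊆ nbhd G S := by
  rintro _ ⟨v, ⟨hv, hne⟩, rfl⟩
  exact ⟨v, hv, hF.adj v hne⟩

theorem disjoint_nbhd {G : SimpleGraph V} {S : Set V} (hS : G.IsIndepSet S) {v : V} (hv : v ∈ S) :
    v ∉ nbhd G S := by
  rintro ⟨u, hu, huv⟩
  exact hS hu hv huv.ne huv

theorem bool_eq_of_ne {p q β : Bool} (h : p ≠ β) (h' : p ≠ q) : q = β := by
  revert p q β
  decide

/-- `X` together with one colour class of `C(G')`. -/
def sideSet (G' : SimpleGraph V) (col : V → Bool) (β : Bool) : Set V :=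
  isoD G' ∪ {v | v ∈ setC G' ∧ col v = β}

namespace IsCycleDecomp

variable {ι : Type*} {G G' : SimpleGraph V} {Y : ι → Set V} [Finite V]

theorem not_adj_setC (h : IsCycleDecomp G G' Y) {u v : V} (hu : u ∈ setD G') (hv : v ∈ setC G') :
    ¬ G.Adj u v := by
  intro huv
  by_cases hvD : v ∈ setD G'
  · exact hv (Or.inl hvD)
  · exact hv (Or.inr ⟨⟨u, hu, (h.adj u hu v huv).symm⟩, hvD⟩)

theorem exists_transversal_notMem (h : IsCycleDecomp G G' Y) {S : Set V} (hS : G.IsIndepSet S) :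
    ∃ w : ι → V, ∀ i, w i ∈ Y i ∧ w i ∉ S := by
  have key : ∀ i, ∃ v ∈ Y i, v ∉ S := by
    intro i
    obtain ⟨x, -, hx, -⟩ := h.two i
    obtain ⟨y, hy, hxy⟩ := h.exists_adj hx
    by_cases hxS : x ∈ S
    · exact ⟨y, hy, fun hyS => hS hxS hyS hxy.ne (h.le hxy)⟩
    · exact ⟨x, hx, hxS⟩
  choose w hw hw' using key
  exact ⟨w, fun i => ⟨hw i, hw' i⟩⟩

variable [Finite ι]

section Matching

variable {w : ι → V} {F : V → V} {S : Set V}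

theorem inter_fix_subset (h : IsCycleDecomp G G' Y) (hF : IsMaxInv G' F)
    (hFw : IsTransversalMatching Y w F) (hwS : ∀ i, w i ∉ S) :
    S ∩ fix F ⊆ fix F ∩ isoD G' := by
  rintro v ⟨hvS, hv⟩
  have hv' := hv
  rw [h.fix_eq hF hFw] at hv'
  rcases hv' with hv' | ⟨i, rfl⟩
  · exact hv'
  · exact (hwS i hvS).elim

/-- As `F` misses no cycle vertex of S, its missed vertices in S lie in X, and it injects the rest
of S into N(S). `eq_of_le` reads off the equality case. -/
theorem ncard_le_ncard_nbhd_add (h : IsCycleDecomp G G' Y) (hF : IsMaxInv G' F)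
    (hFw : IsTransversalMatching Y w F) (hwS : ∀ i, w i ∉ S) :
    S.ncard + (setA G').ncard ≤ (nbhd G S).ncard + (isoD G').ncard := by
  have h1 := Set.ncard_le_ncard ((hF.1.mono h.le).image_subset_nbhd S)
  rw [Set.ncard_image_of_injective _ hF.1.injective] at h1
  have h2 := Set.ncard_le_ncard (h.inter_fix_subset hF hFw hwS)
  have h3 := Set.ncard_inter_add_ncard_sdiff_eq_ncard S (fix F)
  have h4 := h.ncard_fix_inter_isoD_add hF hFw
  omega

theorem eq_of_le (h : IsCycleDecomp G G' Y) (hF : IsMaxInv G' F)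
    (hFw : IsTransversalMatching Y w F) (hwS : ∀ i, w i ∉ S)
    (hS : (nbhd G S).ncard + (isoD G').ncard ≤ S.ncard + (setA G').ncard) :
    S ∩ fix F = fix F ∩ isoD G' ∧ nbhd G S = F '' (S \ fix F) := by
  have h0 := Set.ncard_image_of_injective (S \ fix F) hF.1.injective
  have h1 := Set.ncard_le_ncard ((hF.1.mono h.le).image_subset_nbhd S)
  have h2 := Set.ncard_le_ncard (h.inter_fix_subset hF hFw hwS)
  have h3 := Set.ncard_inter_add_ncard_sdiff_eq_ncard S (fix F)
  have h4 := h.ncard_fix_inter_isoD_add hF hFw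
  exact ⟨Set.eq_of_subset_of_ncard_le (h.inter_fix_subset hF hFw hwS) (by omega),
    (Set.eq_of_subset_of_ncard_le ((hF.1.mono h.le).image_subset_nbhd S) (by omega)).symm⟩

end Matching

theorem indep_sideSet (h : IsCycleDecomp G G' Y) {col : V → Bool}
    (hcol : ∀ u ∈ setC G', ∀ v ∈ setC G', G.Adj u v → col u ≠ col v) (β : Bool) :
    G.IsIndepSet (sideSet G' col β) := by
  have key : ∀ u ∈ isoD G', ∀ v ∈ sideSet G' col β, ¬ G.Adj u v := by
    rintro u hu v (hv | hv) huv
    · exact hu.2 v hv.1 (h.adj u hu.1 v huv)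
    · exact h.not_adj_setC hu.1 hv.1 huv
  rintro u (hu | hu) v hv - huv
  · exact key u hu v hv huv
  · rcases hv with hv | hv
    · exact key v hv u (Or.inr hu) huv.symm
    · exact hcol u hu.1 v hv.1 huv (hu.2.trans hv.2.symm)

theorem nbhd_sideSet_subset (h : IsCycleDecomp G G' Y) {col : V → Bool}
    (hcol : ∀ u ∈ setC G', ∀ v ∈ setC G', G.Adj u v → col u ≠ col v) (β : Bool) :
    nbhd G (sideSet G' col β) ⊆ setA G' ∪ {v | v ∈ setC G' ∧ col v ≠ β} := by
  rintro v ⟨u, hu | hu, huv⟩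
  · exact Or.inl (mem_setA_of_adj hu (h.adj u hu.1 v huv))
  · by_cases hvC : v ∈ setC G'
    · exact Or.inr ⟨hvC, fun e => hcol u hu.1 v hvC huv (hu.2.trans e.symm)⟩
    · rcases not_not.1 hvC with hvD | hvA
      · exact (h.not_adj_setC hvD hu.1 huv.symm).elim
      · exact Or.inl hvA

/-- A maximum matching of `G'` pairs C(G') within itself along edges that change colour, so the
colour classes balance and only |X| - |A| remains. -/
theorem ncard_nbhd_sideSet_le (h : IsCycleDecomp G G' Y) {col : V → Bool}
    (hcol : ∀ u ∈ setC G', ∀ v ∈ setC G', G.Adj u v → col u ≠ col v) (β : Bool) :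
    (nbhd G (sideSet G' col β)).ncard + (isoD G').ncard ≤
      (sideSet G' col β).ncard + (setA G').ncard := by
  obtain ⟨F, hF⟩ := exists_isMaxInv G'
  have h1 := (Set.ncard_le_ncard (h.nbhd_sideSet_subset hcol β)).trans (Set.ncard_union_le _ _)
  have h2 : (sideSet G' col β).ncard =
      (isoD G').ncard + {v | v ∈ setC G' ∧ col v = β}.ncard := by
    refine Set.ncard_union_eq ?_
    rw [Set.disjoint_left]
    exact fun v hv hv' => hv'.1 (Or.inl hv.1)
  have h3 : {v | v ∈ setC G' ∧ col v ≠ β}.ncard ≤ {v | v ∈ setC G' ∧ col v = β}.ncard := by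
    refine Set.ncard_le_ncard_of_injOn F ?_ hF.1.injective.injOn
    rintro v ⟨hvC, hv⟩
    obtain ⟨hne, hFC⟩ := apply_mem_setC hF hvC
    have := hcol v hvC _ hFC (h.le (hF.1.adj v hne))
    refine ⟨hFC, ?_⟩
    exact bool_eq_of_ne hv this
  omega

theorem isCriticalIndepSet_iff (h : IsCycleDecomp G G' Y) {col : V → Bool}
    (hcol : ∀ u ∈ setC G', ∀ v ∈ setC G', G.Adj u v → col u ≠ col v) {S : Set V} :
    IsCriticalIndepSet G S ↔ G.IsIndepSet S ∧
      (nbhd G S).ncard + (isoD G').ncard ≤ S.ncard + (setA G').ncard := by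
  constructor
  · rintro ⟨hS, hmax⟩
    refine ⟨hS, ?_⟩
    have h1 := hmax _ (h.indep_sideSet hcol true)
    have h2 := h.ncard_nbhd_sideSet_le hcol true
    simp only [diff] at h1
    omega
  · rintro ⟨hS, hle⟩
    refine ⟨hS, fun T hT => ?_⟩
    obtain ⟨w, hw⟩ := h.exists_transversal_notMem hT
    obtain ⟨F, hF, hFw⟩ := h.exists_matching w fun i => (hw i).1
    have := h.ncard_le_ncard_nbhd_add hF hFw fun i => (hw i).2
    simp only [diff]
    omega

/-- If S met the cycle at x, choose `F` to miss a neighbour y of x on the cycle. In the equality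
case every vertex of N(S) has its `F`-partner in S, but y is its own partner and is outside S. -/
theorem notMem_of_le (h : IsCycleDecomp G G' Y) {S : Set V} (hS : G.IsIndepSet S)
    (hle : (nbhd G S).ncard + (isoD G').ncard ≤ S.ncard + (setA G').ncard) {i : ι} {x : V}
    (hx : x ∈ Y i) : x ∉ S := by
  classical
  intro hxS
  obtain ⟨y, hy, hxy⟩ := h.exists_adj hx
  have hyS : y ∉ S := fun hyS => hS hxS hyS hxy.ne (h.le hxy)
  obtain ⟨w, hw⟩ := h.exists_transversal_notMem hS
  obtain ⟨F, hF, hFw⟩ := h.exists_matching (Function.update w i y) (fun j => by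
    by_cases hj : j = i
    · subst hj; simpa using hy
    · simpa [hj] using (hw j).1)
  have hyF : F y = y := by simpa using (hFw i).1
  obtain ⟨-, hN⟩ := h.eq_of_le (S := S) hF hFw (fun j => by
    by_cases hj : j = i
    · subst hj; simpa using hyS
    · simpa [hj] using (hw j).2) hle
  have hyN : y ∈ nbhd G S := ⟨x, hxS, h.le hxy⟩
  rw [hN] at hyN
  obtain ⟨s, hs, hsy⟩ := hyN
  have : s = y := hF.1.injective (hsy.trans hyF.symm)
  exact hyS (this ▸ hs.1)

section Cover

variable {w : ι → V} {F : V → V} {S : Set V}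

/-- For critical S, the covered vertices of S and their partners form disjoint sets outside the
cycles and the missed vertices. This bounds |S|, and the sets `sideSet` attain the bound by filling
that whole region. -/
theorem union_image_subset (h : IsCycleDecomp G G' Y) (hS : G.IsIndepSet S)
    (hle : (nbhd G S).ncard + (isoD G').ncard ≤ S.ncard + (setA G').ncard)
    (hF : IsMaxInv G' F) (hFw : IsTransversalMatching Y w F) :
    (S \ fix F) ∪ F '' (S \ fix F) ⊆ (fix F ∪ ⋃ i, Y i)ᶜ := by
  have hSY : ∀ v ∈ S, ∀ i, v ∉ Y i := fun v hv i hi => h.notMem_of_le hS hle hi hv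
  rintro v (⟨hvS, hv⟩ | ⟨v, ⟨hvS, hv⟩, rfl⟩)
  · rintro (hv' | hv')
    · exact hv hv'
    · obtain ⟨i, hi⟩ := Set.mem_iUnion.1 hv'
      exact hSY v hvS i hi
  · rintro (hv' | hv')
    · rw [mem_fix, hF.1.invol] at hv'
      exact hv hv'.symm
    · obtain ⟨i, hi⟩ := Set.mem_iUnion.1 hv'
      exact notMem_cycle hF.1 hFw (hSY v hvS i) hi

theorem ncard_union_image (h : IsCycleDecomp G G' Y) (hS : G.IsIndepSet S)
    (hF : IsMaxInv G' F) :
    ((S \ fix F) ∪ F '' (S \ fix F)).ncard = 2 * (S \ fix F).ncard := by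
  rw [Set.ncard_union_eq, Set.ncard_image_of_injective _ hF.1.injective, two_mul]
  rw [Set.disjoint_left]
  exact fun v hv hv' => disjoint_nbhd hS hv.1 ((hF.1.mono h.le).image_subset_nbhd S hv')

theorem ncard_eq_of_le (h : IsCycleDecomp G G' Y) (hS : G.IsIndepSet S)
    (hle : (nbhd G S).ncard + (isoD G').ncard ≤ S.ncard + (setA G').ncard)
    (hF : IsMaxInv G' F) (hw : ∀ i, w i ∈ Y i) (hFw : IsTransversalMatching Y w F) :
    S.ncard = (fix F ∩ isoD G').ncard + (S \ fix F).ncard := by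
  rw [← (h.eq_of_le hF hFw (fun i => h.notMem_of_le hS hle (hw i)) hle).1,
    Set.ncard_inter_add_ncard_sdiff_eq_ncard]

theorem subset_sideSet_union (h : IsCycleDecomp G G' Y) {col : V → Bool}
    (hcol : ∀ u ∈ setC G', ∀ v ∈ setC G', G.Adj u v → col u ≠ col v) (β : Bool)
    (hF : IsMaxInv G' F) (hFw : IsTransversalMatching Y w F) :
    (fix F ∪ ⋃ i, Y i)ᶜ ⊆
      (sideSet G' col β \ fix F) ∪ F '' (sideSet G' col β \ fix F) := by
  intro v hv
  have hvF : v ∉ fix F := fun e => hv (Or.inl e)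
  have hvY : ∀ i, v ∉ Y i := fun i e => hv (Or.inr (Set.mem_iUnion.2 ⟨i, e⟩))
  have hFvF : F v ∉ fix F := fun e => by
    rw [mem_fix, hF.1.invol] at e
    exact hvF e.symm
  by_cases hvC : v ∈ setC G'
  · by_cases hc : col v = β
    · exact Or.inl ⟨Or.inr ⟨hvC, hc⟩, hvF⟩
    · obtain ⟨hne, hFC⟩ := apply_mem_setC hF hvC
      have := hcol v hvC _ hFC (h.le (hF.1.adj v hne))
      refine Or.inr ⟨F v, ⟨Or.inr ⟨hFC, ?_⟩, hFvF⟩, hF.1.invol v⟩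
      exact bool_eq_of_ne hc this
  · rcases not_not.1 hvC with hvD | hvA
    · exact Or.inl ⟨Or.inl (h.mem_isoD hvD hvY), hvF⟩
    · exact Or.inr ⟨F v, ⟨Or.inl (h.apply_mem_isoD hF hFw hvA), hFvF⟩, hF.1.invol v⟩

end Cover

theorem isMaximumCriticalIndepSet_sideSet (h : IsCycleDecomp G G' Y) {col : V → Bool}
    (hcol : ∀ u ∈ setC G', ∀ v ∈ setC G', G.Adj u v → col u ≠ col v) (β : Bool) :
    IsMaximumCriticalIndepSet G (sideSet G' col β) := by
  have hi := h.indep_sideSet hcol β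
  have hl := h.ncard_nbhd_sideSet_le hcol β
  refine ⟨(h.isCriticalIndepSet_iff hcol).2 ⟨hi, hl⟩, fun T hT => ?_⟩
  obtain ⟨hTi, hTl⟩ := (h.isCriticalIndepSet_iff hcol).1 hT
  obtain ⟨w, hw⟩ := h.exists_transversal
  obtain ⟨F, hF, hFw⟩ := h.exists_matching w hw
  have h1 := h.ncard_eq_of_le hi hl hF hw hFw
  have h2 := h.ncard_eq_of_le hTi hTl hF hw hFw
  have h3 := Set.ncard_le_ncard
    ((h.union_image_subset hTi hTl hF hFw).trans (h.subset_sideSet_union hcol β hF hFw))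
  rw [h.ncard_union_image hTi hF, h.ncard_union_image hi hF] at h3
  omega

/-- Maximality makes S and its partners fill the whole region, so an x in X outside S has its
partner `F x` in S ∩ A. Some maximum matching `g` misses a neighbour d of `F x` in D; then `g` sends
S ∩ A into its `F`-image without hitting d, contrary to injectivity. -/
theorem isoD_subset (h : IsCycleDecomp G G' Y) {col : V → Bool}
    (hcol : ∀ u ∈ setC G', ∀ v ∈ setC G', G.Adj u v → col u ≠ col v) {S : Set V}
    (hS : IsMaximumCriticalIndepSet G S) : isoD G' ⊆ S := by
  obtain ⟨hSi, hSl⟩ := (h.isCriticalIndepSet_iff hcol).1 hS.1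
  obtain ⟨w, hw⟩ := h.exists_transversal
  obtain ⟨F, hF, hFw⟩ := h.exists_matching w hw
  have hi := h.indep_sideSet hcol true
  have hl := h.ncard_nbhd_sideSet_le hcol true
  have hSY : ∀ v ∈ S, ∀ i, v ∉ Y i := fun v hv i hi => h.notMem_of_le hSi hSl hi hv
  obtain ⟨hfixS, hN⟩ := h.eq_of_le hF hFw (fun i => h.notMem_of_le hSi hSl (hw i)) hSl
  have hcover : (S \ fix F) ∪ F '' (S \ fix F) = (fix F ∪ ⋃ i, Y i)ᶜ := by
    refine Set.eq_of_subset_of_ncard_le (h.union_image_subset hSi hSl hF hFw) ?_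
    have h1 := h.ncard_eq_of_le hi hl hF hw hFw
    have h2 := h.ncard_eq_of_le hSi hSl hF hw hFw
    have h3 := Set.ncard_le_ncard (h.subset_sideSet_union hcol true hF hFw)
    have h4 := hS.2 _ (h.isMaximumCriticalIndepSet_sideSet hcol true).1
    rw [h.ncard_union_image hi hF] at h3
    rw [h.ncard_union_image hSi hF]
    omega
  intro x hx
  by_contra hxS
  have hne : F x ≠ x := by
    intro e
    have : x ∈ S ∩ fix F := by rw [hfixS]; exact ⟨e, hx⟩
    exact hxS this.1
  have hxc : x ∈ (S \ fix F) ∪ F '' (S \ fix F) := by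
    rw [hcover]
    rintro (e | e)
    · exact hne e
    · obtain ⟨i, hi⟩ := Set.mem_iUnion.1 e
      exact h.notMem_isoD hi hx
  have hFxS : F x ∈ S := by
    rcases hxc with e | ⟨t, ht, rfl⟩
    · exact (hxS e.1).elim
    · rw [hF.1.invol]; exact ht.1
  -- A neighbour of S is the partner of some t in S. Since t is off the cycles, so is d; if d is in
  -- D it therefore lies in X, and t lies in A.
  have key : ∀ a ∈ S, ∀ d ∈ setD G', G.Adj a d → d ∈ F '' (S ∩ setA G') := by
    intro a ha d hd had
    have hdN : d ∈ nbhd G S := ⟨a, ha, had⟩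
    rw [hN] at hdN
    obtain ⟨t, ht, rfl⟩ := hdN
    have hX := h.mem_isoD hd fun i => notMem_cycle hF.1 hFw (hSY t ht.1 i)
    have hA := apply_mem_setA hF.1 hX (by rw [hF.1.invol]; exact fun e => ht.2 e.symm)
    rw [hF.1.invol] at hA
    exact ⟨t, ⟨ht.1, hA⟩, rfl⟩
  obtain ⟨⟨d, hd, had⟩, -⟩ := apply_mem_setA hF.1 hx hne
  obtain ⟨g, hg, hgd⟩ := mem_setD_iff.1 hd
  have hss : g '' (S ∩ setA G') ⊂ F '' (S ∩ setA G') := by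
    refine ⟨?_, fun hsub => ?_⟩
    · rintro _ ⟨a, ⟨haS, haA⟩, rfl⟩
      exact key a haS _ (hg.mem_setD_of_mem_setA haA)
        (h.le (hg.1.adj a fun e => haA.2 (hg.mem_setD e)))
    · obtain ⟨a, ha, had'⟩ := hsub (key _ hFxS d hd (h.le had))
      have : a = d := hg.1.injective (had'.trans hgd.symm)
      exact ha.2.2 (this ▸ hd)
  have := Set.ncard_lt_ncard hss
  rw [Set.ncard_image_of_injective _ hF.1.injective,
    Set.ncard_image_of_injective _ hg.1.injective] at this
  exact this.false

theorem nucleus_eq (h : IsCycleDecomp G G' Y) {col : V → Bool}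
    (hcol : ∀ u ∈ setC G', ∀ v ∈ setC G', G.Adj u v → col u ≠ col v) :
    nucleus G = isolatedD G ∧ nucleus G ⊆ diadem G := by
  have hmax := h.isMaximumCriticalIndepSet_sideSet hcol
  refine ⟨?_, fun v hv => ⟨_, (hmax true).1, hv _ (hmax true)⟩⟩
  rw [h.isolatedD_eq]
  refine Set.Subset.antisymm (fun v hv => ?_) (fun v hv S hS => h.isoD_subset hcol hS hv)
  rcases hv _ (hmax true) with h1 | h1
  · exact h1
  · rcases hv _ (hmax false) with h2 | h2
    · exact h2
    · exact absurd (h1.2.symm.trans h2.2) (by decide)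

end IsCycleDecomp

/-! ### Disjoint unions -/

section Parts

variable {κ : Type*} (G : SimpleGraph V) (part : V → κ)

/-- The edges of `G` inside the parts. -/
def partGraph : SimpleGraph V where
  Adj u v := G.Adj u v ∧ part u = part v
  symm := ⟨fun _ _ h => ⟨h.1.symm, h.2.symm⟩⟩
  loopless := ⟨fun _ h => h.1.ne rfl⟩

/-- The subgraph induced by a part. -/
abbrev piece (p : κ) : SimpleGraph {v | part v = p} := G.induce {v | part v = p}

variable {part}

/-- The function on `V` made of functions on the parts. -/
def glue (h : ∀ p, {v | part v = p} → {v | part v = p}) : V → V :=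
  fun v => (h (part v) ⟨v, rfl⟩).1

theorem glue_apply (h : ∀ p, {v | part v = p} → {v | part v = p}) {p : κ}
    (x : {v | part v = p}) : glue h x.1 = (h p x).1 := by
  obtain ⟨v, rfl⟩ := x
  rfl

theorem ncard_fix_glue [Finite V] [Fintype κ] (h : ∀ p, {v | part v = p} → {v | part v = p}) :
    (fix (glue h)).ncard = ∑ p, (fix (h p)).ncard := by
  have e : fix (glue h) ≃ Σ p, fix (h p) :=
    { toFun := fun v => ⟨part v.1, ⟨v.1, rfl⟩, Subtype.ext v.2⟩
      invFun := fun x => ⟨x.2.1.1, by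
        rw [mem_fix, glue_apply, x.2.2]⟩
      left_inv := fun _ => rfl
      right_inv := by
        rintro ⟨p, ⟨⟨v, rfl⟩, hv⟩⟩
        rfl }
  rw [← Nat.card_coe_set_eq, Nat.card_congr e, Nat.card_sigma]
  simp only [Nat.card_coe_set_eq]

variable {G}

theorem isInv_glue {h : ∀ p, {v | part v = p} → {v | part v = p}}
    (hh : ∀ p, IsInv (piece G part p) (h p)) : IsInv (partGraph G part) (glue h) := by
  constructor
  · intro v
    change glue h (h (part v) ⟨v, rfl⟩).1 = v
    rw [glue_apply, (hh _).invol]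
  · intro v hv
    have := (hh (part v)).adj ⟨v, rfl⟩ fun e => hv (congrArg Subtype.val e)
    exact ⟨this, (h (part v) ⟨v, rfl⟩).2.symm⟩

theorem exists_glue_eq {f : V → V} (hf : IsInv (partGraph G part) f) :
    ∃ h : ∀ p, {v | part v = p} → {v | part v = p},
      (∀ p, IsInv (piece G part p) (h p)) ∧ glue h = f := by
  have hp : ∀ v, part (f v) = part v := fun v => by
    by_cases hv : f v = v
    · rw [hv]
    · exact (hf.adj v hv).2.symm
  refine ⟨fun p v => ⟨f v, (hp v).trans v.2⟩, fun p => ⟨fun v => ?_, fun v hv => ?_⟩, rfl⟩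
  · exact Subtype.ext (hf.invol v)
  · exact (hf.adj v fun e => hv (Subtype.ext e)).1

/-- Numbers of missed vertices add over the parts, so the total is least exactly when every summand
is. -/
theorem isMaxInv_glue_iff [Finite V] [Finite κ]
    {h : ∀ p, {v | part v = p} → {v | part v = p}} (hh : ∀ p, IsInv (piece G part p) (h p)) :
    IsMaxInv (partGraph G part) (glue h) ↔ ∀ p, IsMaxInv (piece G part p) (h p) := by
  classical
  have := Fintype.ofFinite κ
  constructor
  · intro hmax
    choose m hm using fun p => exists_isMaxInv (piece G part p)
    have h1 := hmax.2 _ (isInv_glue fun p => (hm p).1)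
    rw [ncard_fix_glue, ncard_fix_glue] at h1
    have h2 : ∀ p ∈ Finset.univ, (fix (m p)).ncard ≤ (fix (h p)).ncard :=
      fun p _ => (hm p).2 _ (hh p)
    have h3 := (Finset.sum_eq_sum_iff_of_le h2).1 (le_antisymm (Finset.sum_le_sum h2) h1)
    exact fun p => (hm p).of_le (hh p) (h3 p (Finset.mem_univ p)).ge
  · intro hmax
    refine ⟨isInv_glue hh, fun g hg => ?_⟩
    obtain ⟨m, hm, rfl⟩ := exists_glue_eq hg
    rw [ncard_fix_glue, ncard_fix_glue]
    exact Finset.sum_le_sum fun p _ => (hmax p).2 _ (hm p)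

theorem mem_setD_piece_iff [Finite V] [Finite κ] {p : κ} (x : {v | part v = p}) :
    x ∈ setD (piece G part p) ↔ x.1 ∈ setD (partGraph G part) := by
  classical
  constructor
  · intro hx
    obtain ⟨f, hf, hfx⟩ := mem_setD_iff.1 hx
    choose m hm using fun p => exists_isMaxInv (piece G part p)
    have hmax : ∀ q, IsMaxInv (piece G part q) (Function.update m p f q) := by
      intro q
      by_cases hq : q = p
      · subst hq; simpa using hf
      · simpa [hq] using hm q
    refine ((isMaxInv_glue_iff fun q => (hmax q).1).2 hmax).mem_setD ?_
    rw [glue_apply, Function.update_self, hfx]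
  · intro hx
    obtain ⟨f, hf, hfx⟩ := mem_setD_iff.1 hx
    obtain ⟨h, hh, rfl⟩ := exists_glue_eq hf.1
    refine ((isMaxInv_glue_iff hh).1 hf p).mem_setD (Subtype.ext ?_)
    rw [← glue_apply, hfx]

theorem mem_setA_piece_iff [Finite V] [Finite κ] {p : κ} (x : {v | part v = p}) :
    x ∈ setA (piece G part p) ↔ x.1 ∈ setA (partGraph G part) := by
  refine and_congr ⟨?_, ?_⟩ (mem_setD_piece_iff x).not
  · rintro ⟨y, hy, hxy⟩
    exact ⟨y.1, (mem_setD_piece_iff y).1 hy, hxy, x.2.trans y.2.symm⟩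
  · rintro ⟨y, hy, hxy⟩
    exact ⟨⟨y, hxy.2.symm.trans x.2⟩, (mem_setD_piece_iff _).2 hy, hxy.1⟩

end Parts

/-! ### From BAB-graphs to cycle decompositions -/

theorem IsBAB.exists_isCycleDecomp [Finite V] {G : SimpleGraph V} (hG : IsBAB G) :
    ∃ (k : ℕ) (G' : SimpleGraph V) (Y : Fin k → Set V) (col : V → Bool), IsCycleDecomp G G' Y ∧
      ∀ u ∈ setC G', ∀ v ∈ setC G', G.Adj u v → col u ≠ col v := by
  classical
  obtain ⟨k, part, hbip, hbd, hparts⟩ := hG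
  choose Y hY2 hYe hYm hYc using fun i =>
    exists_cycle_structure (hparts i).1 (hparts i).2.2.1
  -- The ends of an added edge are boundary vertices, hence in A or C of their own part, which
  -- excludes D.
  have hcross : ∀ u v, G.Adj u v → part u ≠ part v → u ∉ setD (partGraph G part) := by
    intro u v huv hne
    cases hu : part u with
    | none =>
      obtain ⟨x, hx, rfl⟩ := hbd ⟨hu, v, fun e => hne (hu.trans (Eq.symm e)), huv⟩
      rw [← mem_setD_piece_iff]
      rcases hx with hx | hx
      · exact hx.2
      · exact fun hD => hx (Or.inl hD)
    | some i =>
      obtain ⟨x, hx, rfl⟩ := (hparts i).2.2.2 ⟨hu, v, fun e => hne (hu.trans (Eq.symm e)), huv⟩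
      rw [← mem_setD_piece_iff]
      exact hx.2
  have hC : ∀ v ∈ setC (partGraph G part), part v = none := by
    intro v hv
    cases hp : part v with
    | none => rfl
    | some i =>
      rcases hYc i ⟨v, hp⟩ with h | h
      · exact (hv (Or.inl ((mem_setD_piece_iff _).1 h))).elim
      · exact (hv (Or.inr ((mem_setA_piece_iff _).1 h))).elim
  obtain ⟨c⟩ := hbip
  -- The colour `true` outside `B` is a dummy value: by `hC`, C(G') lies inside `B`.
  refine ⟨k, partGraph G part, fun i => Subtype.val '' Y i,
    fun v => if h : part v = none then decide (c ⟨v, h⟩ = 0) else true, ⟨?_, ?_, ?_, ?_, ?_, ?_⟩, ?_⟩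
  · exact fun u v h => h.1
  · intro u hu v huv
    exact ⟨huv, by_contra fun hne => hcross u v huv hne hu⟩
  · rintro i j _ ⟨x, -, rfl⟩ ⟨y, -, hxy⟩
    exact Option.some.inj (x.2.symm.trans ((congrArg part hxy).symm.trans y.2))
  · intro i
    obtain ⟨x, y, hx, hy, hxy⟩ := hY2 i
    exact ⟨x, y, ⟨x, hx, rfl⟩, ⟨y, hy, rfl⟩, fun e => hxy (Subtype.ext e)⟩
  · intro u hu v hv huv
    cases hp : part u with
    | none =>
      have hp' : part v = none := huv.2.symm.trans hp
      exact (not_adj_setD_of_isBipartite (u := ⟨u, hp⟩) (v := ⟨v, hp'⟩) ⟨c⟩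
        ((mem_setD_piece_iff (p := none) _).2 hu) ((mem_setD_piece_iff (p := none) _).2 hv)
        huv.1).elim
    | some i =>
      have hp' : part v = some i := huv.2.symm.trans hp
      have hu' := (mem_setD_piece_iff (G := G) (part := part) ⟨u, hp⟩).2 hu
      have hv' := (mem_setD_piece_iff (G := G) (part := part) ⟨v, hp'⟩).2 hv
      exact ⟨i, ⟨_, hYe i _ hu' _ hv' huv.1, rfl⟩, ⟨_, hYe i _ hv' _ hu' huv.1.symm, rfl⟩⟩
  · intro w hw
    choose x hx hxw using hw
    choose f hf hfx hfY using fun i => hYm i (x i) (hx i)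
    obtain ⟨f0, hf0⟩ := exists_isMaxInv (piece G part none)
    let m : ∀ p : Option (Fin k), {v | part v = p} → {v | part v = p} := fun p =>
      match p with
      | none => f0
      | some i => f i
    have hm : ∀ p, IsMaxInv (piece G part p) (m p) := by
      rintro (_ | i)
      · exact hf0
      · exact hf i
    refine ⟨glue m, (isMaxInv_glue_iff fun p => (hm p).1).2 hm, fun i => ⟨?_, ?_⟩⟩
    · rw [← hxw i, glue_apply]
      exact congrArg Subtype.val (hfx i)
    · rintro _ ⟨y, hy, rfl⟩
      obtain ⟨h1, h2⟩ := hfY i y hy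
      rw [glue_apply]
      refine ⟨⟨_, h1, rfl⟩, fun e => ?_⟩
      rw [← hxw i, h2 (Subtype.ext e)]
  · intro u hu v hv huv
    have hpu := hC u hu
    have hpv := hC v hv
    have hc : c ⟨u, hpu⟩ ≠ c ⟨v, hpv⟩ := c.valid huv
    simp only [hpu, hpv, dif_pos]
    intro e
    rw [decide_eq_decide] at e
    apply hc
    revert e
    generalize c ⟨u, hpu⟩ = a
    generalize c ⟨v, hpv⟩ = b
    revert a b
    decide

end BABGraph

theorem mainTheorem4 {V : Type*} [Finite V] (G : SimpleGraph V) (hG : BABGraph.IsBAB G) :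
    BABGraph.nucleus G = BABGraph.isolatedD G ∧
      BABGraph.nucleus G ⊆ BABGraph.diadem G := by
  obtain ⟨k, G', Y, col, h, hcol⟩ := hG.exists_isCycleDecomp
  exact h.nucleus_eq hcol
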